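/- Let $\lambda,\mu,\nu>0$ with $\rho=\lambda/\mu<1$. Consider a single-server first-come first-served (infinite buffer) update-and-decide system that starts empty at time $0$: the inter-arrival times $X_1,X_2,\dots$ of the updates are exponential with mean $1/\lambda$, the service times $S_1,S_2,\dots$ are identically distributed with mean $1/\mu$, the inter-decision times $Z_1,Z_2,\dots$ are exponential with mean $1/\nu$, and all these random variables are mutually independent. Update $k$ arrives at $t_k=X_1+\dots+X_k$ and departs at $t_k'=\max(t_k,t_{k-1}')+S_k$, with $t_0=t_0'=0$; the $j$-th decision is made at $\tau_j=Z_1+\dots+Z_j$. The age upon decision (AuD) is $\Delta_{\mathrm D}(\tau_j)=\tau_j-t_{N_{\mathrm U}(\tau_j)}$, where $N_{\mathrm U}(\tau)=\max\{k\ge 0: t_k'\le\tau\}$. Let $N_T$ be the number of decisions made up to time $T$. Then the average AuD $$\overline{\Delta}_{\mathrm D}=\lim_{T\to\infty}\frac1{N_T}\sum_{j=1}^{N_T}\Delta_{\mathrm D}(\tau_j)$$ exists almost surely, and it is almost surely equal to the following constants. If the service times are uniformly distributed on $(0,2/\mu)$ (M/U/1/M), $$\overline{\Delta}_{\mathrm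 D}=\frac{\rho\,(6\rho^{2}e^{2\rho}-13\rho e^{2\rho}+9e^{2\rho}+\rho-3)}{3\lambda(1-\rho)(e^{2\rho}-1)}.$$ If the service times are exponential with rate $\mu$ (M/M/1/M), $$\overline{\Delta}_{\mathrm D}=\frac{\rho^{3}-\rho^{2}+1}{\lambda(1-\rho)}.$$ If the service times are all equal to $1/\mu$ (M/D/1/M), $$\overline{\Delta}_{\mathrm D}=\frac{\rho^{2}+2(1-\rho)(\rho+e^{\rho}-\rho e^{\rho})}{2\lambda(1-\rho)}.$$ -/

import Mathlib

open MeasureTheory ProbabilityTheory Filter Topology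

noncomputable section

/-! A sample path of an update-and-decide system is given by three real sequences
`x`, `s`, `z`: `x i` is the time between the arrivals of the updates `i` and `i + 1`, `s i` is the
service time of update `i + 1`, and `z i` is the time between the decisions `i` and `i + 1`
(`i = 0, 1, 2, …`).  Updates and decisions are numbered from `1`; the index `0` stands for the
start of the system at time `0`, with an empty queue. -/

namespace UpdateDecide

/-- The epoch of the `n`-th event when the successive inter-event times are `x 0, x 1, …`:
the arrival time `t_k` of update `k`, or the time `τ_j` of the `j`-th decision. -/
def epoch (x : ℕ → ℝ) (n : ℕ) : ℝ := ∑ i ∈ Finset.range n, x i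

/-- The departure time `t'_k` of update `k` under first-come first-served service by a single
server: the service of an update starts as soon as the update has arrived and the previous one
has left. -/
def departure (x s : ℕ → ℝ) : ℕ → ℝ
  | 0 => 0
  | k + 1 => max (epoch x (k + 1)) (departure x s k) + s k

/-- `N_U(t) = max {k | t'_k ≤ t}`, the index of the most recently received update at time `t`.
(For `t ≥ 0` the set contains `0`; it is bounded as soon as the departure times tend to
infinity.) -/
def lastReceived (x s : ℕ → ℝ) (t : ℝ) : ℕ := sSup {k : ℕ | departure x s k ≤ t}

/-- The age `t - U(t)` of the most recently received update at time `t`, where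
`U(t) = t_{N_U(t)}` is its generation time. -/
def age (x s : ℕ → ℝ) (t : ℝ) : ℝ := t - epoch x (lastReceived x s t)

/-- The age upon decision `Δ_D(τ_j)`. -/
def ageUponDecision (x s z : ℕ → ℝ) (j : ℕ) : ℝ := age x s (epoch z j)

/-- The number `N_T` of decisions made in the period `[0, T]`. -/
def numDecisions (z : ℕ → ℝ) (T : ℝ) : ℕ := Set.ncard {j : ℕ | 1 ≤ j ∧ epoch z j ≤ T}

/-- The mean age upon decisions over the period `[0, T]`. -/
def meanAuD (x s z : ℕ → ℝ) (T : ℝ) : ℝ :=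
  (1 / (numDecisions z T : ℝ)) *
    ∑ j ∈ Finset.Icc 1 (numDecisions z T), ageUponDecision x s z j

variable {Ω : Type*} [MeasurableSpace Ω]

/-- `X`, `S`, `Z` are the inter-arrival, service and inter-decision times of an M/G/1/M
update-and-decide system with arrival rate `lam`, service time distribution `serviceLaw` and
decision rate `ν`: each sequence is identically distributed with the stated law, and all these
random variables are mutually independent. -/
structure IsMG1M (P : Measure Ω) (X S Z : ℕ → Ω → ℝ) (lam : ℝ) (serviceLaw : Measure ℝ)
    (ν : ℝ) : Prop where
  law_interarrival : ∀ i, HasLaw (X i) (expMeasure lam) P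
  law_service : ∀ i, HasLaw (S i) serviceLaw P
  law_interdecision : ∀ i, HasLaw (Z i) (expMeasure ν) P
  indep : iIndepFun (Sum.elim X (Sum.elim S Z)) P

/-- The average AuD of the system exists and equals `Δ`: almost surely, the mean age upon
decisions over `[0, T]` tends to `Δ` as `T → ∞`. -/
def HasAverageAuD (P : Measure Ω) (X S Z : ℕ → Ω → ℝ) (Δ : ℝ) : Prop :=
  ∀ᵐ ω ∂P, Tendsto (meanAuD (fun i => X i ω) (fun i => S i ω) (fun i => Z i ω)) atTop (𝓝 Δ)

/-- The uniform distribution on `(0, 2 / μ)`, of mean `1 / μ`. -/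
def uniformService (μ : ℝ) : Measure ℝ := cond volume (Set.Ioo 0 (2 / μ))

/-- The exponential distribution of mean `1 / μ`. -/
def exponentialService (μ : ℝ) : Measure ℝ := expMeasure μ

/-- The deterministic service time `1 / μ`. -/
def deterministicService (μ : ℝ) : Measure ℝ := Measure.dirac (1 / μ)

end UpdateDecide

end

/-! The decisions form a Poisson process independent of the arrivals and services, so they see time
averages, and the average AuD is the time average of the age, whatever `ν` is. For a service time
`S` of general law with `ρ = lam * E S < 1` and an exponential moment, this average is `E S + lam *
E S ^ 2 / (2 * (1 - ρ)) + (1 - ρ) / (lam * E exp (-lam * S))`. The three stated constants are this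
formula for the three laws.

Time average. Let `T k` be the system time of update `k` and `x k` the gap between arrivals `k` and
`k + 1`. Between departures `k` and `k + 1` the age rises with slope one from `T k` to `x k + T (k +
1)`. The area below it is `x k ^ 2 / 2 + x k * T (k + 1)` plus a telescoping term
(`integral_age_departure`). No stationary law is needed to average these areas. Since `T` is a
Markov chain (`systemTime_succ`), an explicit potential `α y + β y ^ 2 + γ exp (-lam y)` solves the
Poisson equation (`integral_areaIncrement_eq_zero`). Up to telescoping, area minus its mean is then
a martingale difference.

Decisions. Given the whole arrival and service path, the age at the next decision minus `ν` times
its integral since the previous decision has mean zero, because `P (Z > v) = exp (-ν v)` is the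
density of `Z` divided by `ν` (`integral_integral_expMeasure`). These differences are again
martingale increments, and their sum compares decision averages with time averages
(`sum_decisionIncrement_eq`).

Both averages vanish by one strong law (`ae_tendsto_average_zero_of_indep`), from `L²` martingale
convergence and Kronecker's lemma. The second moments it requires come from a geometric drift of
`exp (θ T)` (`exists_exp_systemTime_bound`) and, for the decisions, from capping the age at a level
that typical paths do not reach. -/

namespace UpdateDecide

/-! ### Strong law for martingale differences -/

/-- Kronecker's lemma with the weights `k + 1`. -/
lemma tendsto_average_zero_of_tendsto_sum_div {a : ℕ → ℝ} {l : ℝ}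
    (h : Tendsto (fun n => ∑ k ∈ Finset.range n, a k / (k + 1)) atTop (𝓝 l)) :
    Tendsto (fun n : ℕ => (∑ k ∈ Finset.range n, a k) / n) atTop (𝓝 0) := by
  set S : ℕ → ℝ := fun n => ∑ k ∈ Finset.range n, a k / (k + 1) with hS
  -- Summation by parts. After division by `n`, the right side is a convergent sequence minus its
  -- own Cesàro means.
  have key : ∀ n : ℕ, ∑ k ∈ Finset.range n, a k = n * S n - ∑ k ∈ Finset.range n, S k := by
    intro n
    induction n with
    | zero => simp
    | succ n ih =>
      have hn : (n : ℝ) + 1 ≠ 0 := by positivity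
      rw [Finset.sum_range_succ, ih, Finset.sum_range_succ S]
      have : S (n + 1) = S n + a n / (n + 1) := by simp [hS, Finset.sum_range_succ]
      rw [this]
      push_cast
      field_simp
      ring
  have h2 := h.sub h.cesaro
  rw [sub_self] at h2
  refine h2.congr' ?_
  filter_upwards [eventually_gt_atTop 0] with n hn
  have hn' : (n : ℝ) ≠ 0 := by positivity
  rw [key n]
  field_simp

/-- If `W` and `Y` are known at a time at which `U` is independent of the past, and `g (y, U)` has
mean zero for the relevant `y`, then `W * g (Y, U)` has mean zero. -/
lemma integral_mul_eq_zero_of_indep {Ω E F : Type*} {m mΩ : MeasurableSpace Ω}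
    [MeasurableSpace E] [MeasurableSpace F] {P : Measure Ω} [IsProbabilityMeasure P]
    (hm : m ≤ mΩ) {W : Ω → ℝ}
    (hW : Measurable[m] W) {Y : Ω → E} (hY : Measurable[m] Y) {U : Ω → F} (hU : Measurable U)
    (hind : Indep m (MeasurableSpace.comap U inferInstance) P) {g : E × F → ℝ} (hg : Measurable g)
    (hint : Integrable (fun ω => W ω * g (Y ω, U ω)) P)
    (hz : ∀ᵐ ω ∂P, ∫ u, g (Y ω, u) ∂(P.map U) = 0) :
    ∫ ω, W ω * g (Y ω, U ω) ∂P = 0 := by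
  have hWY : Measurable[m] (fun ω => (W ω, Y ω)) := hW.prodMk hY
  have hWY' : Measurable (fun ω => (W ω, Y ω)) := hWY.mono hm le_rfl
  have hi : IndepFun (fun ω => (W ω, Y ω)) U P :=
    indep_of_indep_of_le_left hind hWY.comap_le
  have hmap := (indepFun_iff_map_prod_eq_prod_map_map hWY'.aemeasurable hU.aemeasurable).1 hi
  have : IsProbabilityMeasure (P.map U) := Measure.isProbabilityMeasure_map hU.aemeasurable
  have : IsProbabilityMeasure (P.map fun ω => (W ω, Y ω)) :=
    Measure.isProbabilityMeasure_map hWY'.aemeasurable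
  let f : (ℝ × E) × F → ℝ := fun p => p.1.1 * g (p.1.2, p.2)
  have hf : Measurable f := by fun_prop
  have hint' : Integrable f (P.map fun ω => ((W ω, Y ω), U ω)) :=
    (integrable_map_measure hf.aestronglyMeasurable (hWY'.prodMk hU).aemeasurable).2 hint
  calc ∫ ω, W ω * g (Y ω, U ω) ∂P
      = ∫ p, f p ∂(P.map fun ω => ((W ω, Y ω), U ω)) :=
        (integral_map (hWY'.prodMk hU).aemeasurable hf.aestronglyMeasurable).symm
    _ = ∫ q, ∫ u, f (q, u) ∂(P.map U) ∂(P.map fun ω => (W ω, Y ω)) := by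
        rw [hmap] at hint' ⊢
        exact integral_prod f hint'
    _ = ∫ ω, ∫ u, f ((W ω, Y ω), u) ∂(P.map U) ∂P :=
        integral_map hWY'.aemeasurable
          (hf.stronglyMeasurable.integral_prod_right').aestronglyMeasurable
    _ = 0 := by
        refine integral_eq_zero_of_ae ?_
        filter_upwards [hz] with ω hω
        simp only [f, integral_const_mul, hω, mul_zero, Pi.zero_apply]

/-- A strong law of large numbers for the martingale differences `g (Y n, U n)`, where `Y n` is
known at time `n` and `U n` is independent of the past. -/
theorem ae_tendsto_average_zero_of_indep {Ω E F : Type*} {mΩ : MeasurableSpace Ω}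
    [MeasurableSpace E] [MeasurableSpace F] {P : Measure Ω} [IsProbabilityMeasure P]
    (ℱ : Filtration ℕ mΩ) {Y : ℕ → Ω → E} {U : ℕ → Ω → F}
    {g : E × F → ℝ} (hY : ∀ n, Measurable[ℱ n] (Y n)) (hU : ∀ n, Measurable[ℱ (n + 1)] (U n))
    (hind : ∀ n, Indep (ℱ n) (MeasurableSpace.comap (U n) inferInstance) P) (hg : Measurable g)
    (hz : ∀ n, ∀ᵐ ω ∂P, ∫ u, g (Y n ω, u) ∂(P.map (U n)) = 0)
    {b : ℕ → ℝ} (hL2 : ∀ n, Integrable (fun ω => g (Y n ω, U n ω) ^ 2) P)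
    (hb : ∀ n, ∫ ω, g (Y n ω, U n ω) ^ 2 ∂P ≤ b n)
    (hsum : Summable fun n : ℕ => b n / (n + 1) ^ 2) :
    ∀ᵐ ω ∂P, Tendsto (fun n : ℕ => (∑ k ∈ Finset.range n, g (Y k ω, U k ω)) / n) atTop (𝓝 0) := by
  set D : ℕ → Ω → ℝ := fun n ω => g (Y n ω, U n ω) with hD
  have hUm : ∀ n, Measurable (U n) := fun n => (hU n).mono (ℱ.le _) le_rfl
  have hDm : ∀ n, Measurable[ℱ (n + 1)] (D n) := fun n =>
    hg.comp (((hY n).mono (ℱ.mono n.le_succ) le_rfl).prodMk (hU n))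
  have hDm' : ∀ n, Measurable (D n) := fun n => (hDm n).mono (ℱ.le _) le_rfl
  have hDL : ∀ n, MemLp (D n) 2 P := fun n =>
    (memLp_two_iff_integrable_sq (hDm' n).aestronglyMeasurable).2 (hL2 n)
  -- The weights `1 / (k + 1)` make `M` bounded in `L²`, hence almost surely convergent; Kronecker's
  -- lemma then gives the average of the unweighted differences.
  set M : ℕ → Ω → ℝ := fun n ω => ∑ k ∈ Finset.range n, D k ω / (k + 1) with hM
  have hMs : ∀ n ω, M (n + 1) ω = M n ω + D n ω / (n + 1) := fun n ω => by
    simp [hM, Finset.sum_range_succ]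
  have hMm : ∀ n, Measurable[ℱ n] (M n) := fun n => by
    refine Finset.measurable_sum (m := ℱ n) _ fun k hk => ?_
    exact ((hDm k).mono (ℱ.mono (Finset.mem_range.1 hk)) le_rfl).div_const _
  have hML : ∀ n, MemLp (M n) 2 P := fun n => by
    refine memLp_finsetSum _ fun k _ => ?_
    simpa [div_eq_inv_mul] using (hDL k).const_mul (((k : ℝ) + 1)⁻¹)
  have hMint : ∀ n, Integrable (M n) P := fun n => (hML n).integrable one_le_two
  have hDint : ∀ n, Integrable (D n) P := fun n => (hDL n).integrable one_le_two
  have horth : ∀ n, ∫ ω, M n ω * D n ω ∂P = 0 := fun n =>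
    integral_mul_eq_zero_of_indep (ℱ.le n) (hMm n) (hY n) (hUm n) (hind n) hg
      ((hML n).integrable_mul (hDL n)) (hz n)
  have hmart : Martingale M ℱ P := by
    refine martingale_of_setIntegral_eq_succ (fun n => (hMm n).stronglyMeasurable) hMint ?_
    intro n s hs
    have h0 : ∫ ω in s, D n ω ∂P = 0 := by
      have hsm : MeasurableSet s := ℱ.le n s hs
      rw [← integral_indicator hsm]
      -- The martingale property is the same orthogonality, tested with the indicator of a past
      -- event in place of `M n`.
      have := integral_mul_eq_zero_of_indep (W := s.indicator fun _ => (1 : ℝ)) (ℱ.le n)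
        (Measurable.indicator (@measurable_const _ _ _ (ℱ n) _) hs) (hY n) (hUm n) (hind n) hg
        (by
          refine ((hDint n).indicator hsm).congr (.of_forall fun ω => ?_)
          by_cases h : ω ∈ s <;> simp [h, hD]) (hz n)
      rw [← this]
      refine integral_congr_ae (.of_forall fun ω => ?_)
      by_cases h : ω ∈ s <;> simp [h, hD]
    simp_rw [hMs]
    rw [integral_add (hMint n).integrableOn ((hDint n).div_const _).integrableOn,
      integral_div, h0]
    simp
  have hMsq : ∀ n, ∫ ω, M n ω ^ 2 ∂P ≤ ∑ k ∈ Finset.range n, b k / (k + 1) ^ 2 := by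
    intro n
    induction n with
    | zero => simp [hM]
    | succ n ih =>
      have e : ∀ ω, M (n + 1) ω ^ 2 =
          M n ω ^ 2 + (2 / ((n : ℝ) + 1)) * (M n ω * D n ω) + D n ω ^ 2 / ((n : ℝ) + 1) ^ 2 := by
        intro ω
        have hn : (n : ℝ) + 1 ≠ 0 := by positivity
        rw [hMs]
        field_simp
        ring
      have i1 : Integrable (fun ω => M n ω ^ 2) P := (hML n).integrable_sq
      have i2 : Integrable (fun ω => (2 / ((n : ℝ) + 1)) * (M n ω * D n ω)) P :=
        ((hML n).integrable_mul (hDL n)).const_mul _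
      have i3 : Integrable (fun ω => D n ω ^ 2 / ((n : ℝ) + 1) ^ 2) P := (hL2 n).div_const _
      have i12 : Integrable (fun ω => M n ω ^ 2 + (2 / ((n : ℝ) + 1)) * (M n ω * D n ω)) P :=
        i1.add i2
      simp_rw [e]
      rw [integral_add i12 i3, integral_add i1 i2, integral_const_mul, horth,
        integral_div, Finset.sum_range_succ]
      have := div_le_div_of_nonneg_right (hb n) (sq_nonneg ((n : ℝ) + 1))
      linarith
  have hb0 : ∀ n, 0 ≤ b n := fun n => (integral_nonneg fun ω => sq_nonneg _).trans (hb n)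
  set B := ∑' n : ℕ, b n / ((n : ℝ) + 1) ^ 2
  have hB : ∀ n, ∫ ω, M n ω ^ 2 ∂P ≤ B := fun n => (hMsq n).trans
    (hsum.sum_le_tsum _ fun k _ => div_nonneg (hb0 k) (sq_nonneg _))
  -- The convergence theorem asks for an `L¹` bound; `|M| ≤ 1 + M ^ 2` supplies it.
  have hbdd : ∀ n, eLpNorm (M n) 1 P ≤ ((1 + B).toNNReal : ENNReal) := by
    intro n
    rw [eLpNorm_one_eq_lintegral_enorm, ← ofReal_integral_norm_eq_lintegral_enorm (hMint n)]
    refine ENNReal.ofReal_le_ofReal ?_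
    calc ∫ ω, ‖M n ω‖ ∂P ≤ ∫ ω, (1 + M n ω ^ 2) ∂P := by
          refine integral_mono (hMint n).norm ((integrable_const _).add (hML n).integrable_sq) ?_
          intro ω
          have : |M n ω| ^ 2 = M n ω ^ 2 := sq_abs _
          simp only [Real.norm_eq_abs]
          nlinarith [sq_nonneg (|M n ω| - 1), abs_nonneg (M n ω)]
      _ = 1 + ∫ ω, M n ω ^ 2 ∂P := by
          rw [integral_add (integrable_const _) (hML n).integrable_sq]; simp
      _ ≤ 1 + B := by linarith [hB n]
  filter_upwards [hmart.submartingale.exists_ae_tendsto_of_bdd hbdd] with ω ⟨l, hl⟩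
  exact tendsto_average_zero_of_tendsto_sum_div hl

/-- Random variables with bounded second moments grow at most linearly. -/
lemma ae_exists_le_of_integral_sq_le {Ω : Type*} {mΩ : MeasurableSpace Ω} {P : Measure Ω}
    {V : ℕ → Ω → ℝ} {B : ℝ}
    (hV : ∀ n, Integrable (fun ω => V n ω ^ 2) P) (hB : ∀ n, ∫ ω, V n ω ^ 2 ∂P ≤ B) :
    ∀ᵐ ω ∂P, ∃ C, ∀ n : ℕ, V n ω ≤ C * (n + 1) := by
  -- The sum of `V n ^ 2 / (n + 1) ^ 2` has finite mean, so it is almost surely finite and bounds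
  -- each of its terms.
  have h1 : ∑' n : ℕ, ∫⁻ ω, ENNReal.ofReal (V n ω ^ 2 / (n + 1) ^ 2) ∂P ≠ ⊤ := by
    have hs : Summable fun n : ℕ => B / ((n : ℝ) + 1) ^ 2 := by
      have := ((summable_nat_add_iff 1).2 (Real.summable_one_div_nat_pow.2 one_lt_two)).mul_left B
      simpa [div_eq_mul_inv] using this
    refine ne_top_of_le_ne_top hs.tsum_ofReal_ne_top (ENNReal.tsum_le_tsum fun n => ?_)
    rw [← ofReal_integral_eq_lintegral_ofReal ((hV n).div_const _)
      (.of_forall fun ω => by positivity), integral_div]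
    exact ENNReal.ofReal_le_ofReal (div_le_div_of_nonneg_right (hB n) (by positivity))
  have hae : ∀ n : ℕ, AEMeasurable (fun ω => ENNReal.ofReal (V n ω ^ 2 / (n + 1) ^ 2)) P :=
    fun n => ((hV n).div_const _).aestronglyMeasurable.aemeasurable.ennreal_ofReal
  rw [← lintegral_tsum hae] at h1
  filter_upwards [ae_lt_top' (AEMeasurable.tsum hae) h1] with ω hω
  refine ⟨1 + (∑' n : ℕ, ENNReal.ofReal (V n ω ^ 2 / (n + 1) ^ 2)).toReal, fun n => ?_⟩
  have h2 : V n ω ^ 2 / ((n : ℝ) + 1) ^ 2 ≤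
      (∑' n : ℕ, ENNReal.ofReal (V n ω ^ 2 / (n + 1) ^ 2)).toReal := by
    rw [← ENNReal.ofReal_le_iff_le_toReal hω.ne]
    exact ENNReal.le_tsum (f := fun n : ℕ => ENNReal.ofReal (V n ω ^ 2 / (n + 1) ^ 2)) n
  have hn : (0 : ℝ) < n + 1 := by positivity
  rw [← div_le_iff₀ hn]
  rw [← div_pow] at h2
  nlinarith [sq_nonneg (V n ω / (n + 1) - 1)]

/-! ### Integrals against the exponential law -/

section ExponentialLaw

variable {r : ℝ}

lemma expMeasure_eq_withDensity (r : ℝ) : expMeasure r =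
    (volume.restrict (Set.Ioi 0)).withDensity fun x => ENNReal.ofReal (r * Real.exp (-(r * x))) := by
  rw [← withDensity_indicator measurableSet_Ioi, expMeasure, gammaMeasure]
  refine withDensity_congr_ae ?_
  have : ∀ᵐ x : ℝ, x ≠ 0 := by simp [ae_iff]
  filter_upwards [this] with x hx
  change exponentialPDF r x = _
  rw [exponentialPDF_eq]
  rcases lt_or_gt_of_ne hx with h | h
  · simp [h.le, not_le.2 h]
  · simp [h, h.le]

lemma integral_expMeasure (hr : 0 < r) (f : ℝ → ℝ) :
    ∫ x, f x ∂expMeasure r = ∫ x in Set.Ioi 0, f x * (r * Real.exp (-(r * x))) := by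
  rw [expMeasure_eq_withDensity, integral_withDensity_eq_integral_toReal_smul (by fun_prop) (by simp)]
  refine integral_congr_ae (.of_forall fun x => ?_)
  have : 0 ≤ r * Real.exp (-(r * x)) := by positivity
  simp only [ENNReal.toReal_ofReal this, smul_eq_mul]
  ring

lemma integrable_expMeasure_iff (hr : 0 < r) (f : ℝ → ℝ) :
    Integrable f (expMeasure r) ↔
      IntegrableOn (fun x => f x * (r * Real.exp (-(r * x)))) (Set.Ioi 0) := by
  rw [expMeasure_eq_withDensity, integrable_withDensity_iff (by fun_prop) (by simp), IntegrableOn]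
  refine integrable_congr (.of_forall fun x => ?_)
  have : 0 ≤ r * Real.exp (-(r * x)) := by positivity
  simp only [ENNReal.toReal_ofReal this]

lemma ae_expMeasure_pos (r : ℝ) : ∀ᵐ x ∂expMeasure r, 0 < x := by
  rw [expMeasure_eq_withDensity]
  exact (withDensity_absolutelyContinuous _ _).ae_le (ae_restrict_mem measurableSet_Ioi)

lemma integrable_exp_mul_expMeasure (hr : 0 < r) {t : ℝ} (ht : t < r) :
    Integrable (fun x => Real.exp (t * x)) (expMeasure r) := by
  rw [integrable_expMeasure_iff hr]
  have := (integrableOn_exp_mul_Ioi (a := t - r) (by linarith) 0).const_mul r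
  refine this.congr (.of_forall fun x => ?_)
  simp only
  rw [show (t - r) * x = t * x + -(r * x) by ring, Real.exp_add]
  ring

lemma integral_exp_mul_expMeasure (hr : 0 < r) {t : ℝ} (ht : t < r) :
    ∫ x, Real.exp (t * x) ∂expMeasure r = r / (r - t) := by
  rw [integral_expMeasure hr]
  have h : ∀ x : ℝ, Real.exp (t * x) * (r * Real.exp (-(r * x))) = r * Real.exp ((t - r) * x) := by
    intro x
    rw [show (t - r) * x = t * x + -(r * x) by ring, Real.exp_add]
    ring
  simp_rw [h]
  rw [integral_const_mul, integral_exp_mul_Ioi (by linarith)]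
  have : t - r ≠ 0 := by linarith
  have : r - t ≠ 0 := by linarith
  simp only [mul_zero, Real.exp_zero]
  field_simp
  ring

lemma measureReal_expMeasure_Ioi (hr : 0 < r) {v : ℝ} (hv : 0 ≤ v) :
    (expMeasure r).real (Set.Ioi v) = Real.exp (-(r * v)) := by
  have := isProbabilityMeasure_expMeasure hr
  rw [← Set.compl_Iic, probReal_compl_eq_one_sub measurableSet_Iic, ← cdf_eq_real,
    cdf_expMeasure_eq hr, if_pos hv]
  ring

/-- Integrating `f` up to an exponential time of rate `r` gives on average `1 / r` times the mean
of `f` at that time. -/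
lemma integral_integral_expMeasure (hr : 0 < r) {f : ℝ → ℝ} (hf : Measurable f)
    (hi : Integrable f (expMeasure r)) :
    ∫ u, (∫ v in Set.Ioo 0 u, f v) ∂expMeasure r = (∫ x, f x ∂expMeasure r) / r := by
  have := isProbabilityMeasure_expMeasure hr
  set k : ℝ → ℝ → ℝ := fun u v => (Set.Ioo 0 u).indicator f v with hk
  have hset : MeasurableSet {p : ℝ × ℝ | p.2 ∈ Set.Ioo 0 p.1} :=
    (measurableSet_lt measurable_const measurable_snd).inter
      (measurableSet_lt measurable_snd measurable_fst)
  have hkm : Measurable (Function.uncurry k) := by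
    have : Function.uncurry k = {p : ℝ × ℝ | p.2 ∈ Set.Ioo 0 p.1}.indicator fun p => f p.2 := by
      ext p
      simp [k, Function.uncurry, Set.indicator]
    rw [this]
    exact (hf.comp measurable_snd).indicator hset
  -- For fixed `v`, averaging the indicator of `v < u` over `u` gives the tail `exp (-(r * v))`,
  -- which is the density at `v` divided by `r`.
  have hkv : ∀ h : ℝ → ℝ, ∀ v, ∫ u, (Set.Ioo 0 u).indicator h v ∂expMeasure r =
      (Set.Ioi 0).indicator (fun v => h v * Real.exp (-(r * v))) v := by
    intro h v
    by_cases hv : 0 < v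
    · have : ∀ u, (Set.Ioo 0 u).indicator h v = (Set.Ioi v).indicator (fun _ => h v) u := by
        intro u
        simp [Set.indicator, hv]
      simp_rw [this]
      rw [integral_indicator measurableSet_Ioi, setIntegral_const, smul_eq_mul,
        measureReal_expMeasure_Ioi hr hv.le]
      simp [hv, mul_comm]
    · simp [Set.indicator, hv]
  have hfi := (integrable_expMeasure_iff hr f).1 hi
  have hfi' : IntegrableOn (fun v => f v * Real.exp (-(r * v))) (Set.Ioi 0) := by
    have := hfi.const_mul r⁻¹
    refine this.congr (.of_forall fun x => ?_)
    field_simp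
  have hint : Integrable (Function.uncurry k) ((expMeasure r).prod volume) := by
    rw [integrable_prod_iff' hkm.aestronglyMeasurable]
    constructor
    · refine .of_forall fun v => ?_
      refine Integrable.of_bound (C := |f v|) ?_ (.of_forall fun u => ?_)
      · exact (hkm.comp measurable_prodMk_right).aestronglyMeasurable
      · simp only [k, Function.uncurry, Set.indicator]
        split_ifs <;> simp
    · have : ∀ u v, ‖Function.uncurry k (u, v)‖ = (Set.Ioo 0 u).indicator (fun v => |f v|) v := by
        intro u v
        simp only [k, Function.uncurry, Set.indicator]
        split_ifs <;> simp
      simp_rw [this, hkv]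
      rw [integrable_indicator_iff measurableSet_Ioi]
      refine hfi'.norm.congr (.of_forall fun v => ?_)
      simp
  calc ∫ u, (∫ v in Set.Ioo 0 u, f v) ∂expMeasure r = ∫ u, (∫ v, k u v) ∂expMeasure r := by
        simp_rw [hk, integral_indicator measurableSet_Ioo]
    _ = ∫ v, ∫ u, k u v ∂expMeasure r := integral_integral_swap hint
    _ = ∫ v in Set.Ioi 0, f v * Real.exp (-(r * v)) := by
        simp_rw [hk, hkv]
        rw [integral_indicator measurableSet_Ioi]
    _ = (∫ x, f x ∂expMeasure r) / r := by
        rw [integral_expMeasure hr, ← integral_div]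
        refine integral_congr_ae (.of_forall fun x => ?_)
        field_simp

/-- A law on `[0, ∞)` with an exponential moment has moments of all orders. -/
lemma integrable_pow_of_exp {κ : Measure ℝ} [IsProbabilityMeasure κ] (h0 : ∀ᵐ s ∂κ, 0 ≤ s) {t : ℝ}
    (ht : 0 < t) (hi : Integrable (fun s => Real.exp (t * s)) κ) (n : ℕ) :
    Integrable (fun s => s ^ n) κ := by
  have hn : Integrable (fun s => Real.exp (-t * s)) κ := by
    refine Integrable.of_bound (C := 1) (by fun_prop) ?_
    filter_upwards [h0] with s hs
    rw [Real.norm_eq_abs, abs_of_pos (Real.exp_pos _), Real.exp_le_one_iff]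
    nlinarith
  exact integrable_pow_of_integrable_exp_mul (X := fun s => s) ht.ne' hi hn n

lemma integrable_pow_expMeasure (hr : 0 < r) (n : ℕ) :
    Integrable (fun x => x ^ n) (expMeasure r) := by
  have := isProbabilityMeasure_expMeasure hr
  exact integrable_pow_of_exp ((ae_expMeasure_pos r).mono fun _ h => h.le) (half_pos hr)
    (integrable_exp_mul_expMeasure hr (half_lt_self hr)) n

lemma integral_id_expMeasure (hr : 0 < r) : ∫ x, x ∂expMeasure r = 1 / r := by
  have := isProbabilityMeasure_expMeasure hr
  -- The integral of `1` up to `u` is `u`, so the mean follows from the tail identity without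
  -- integration by parts; the second moment uses `2 * x` likewise.
  have h := integral_integral_expMeasure hr (f := fun _ => 1) measurable_const (integrable_const _)
  rw [← show (∫ u, (∫ v in Set.Ioo 0 u, (1 : ℝ)) ∂expMeasure r) = ∫ x, x ∂expMeasure r from ?_, h]
  · simp
  · refine integral_congr_ae ?_
    filter_upwards [ae_expMeasure_pos r] with x hx
    simp [hx.le]

lemma integral_sq_expMeasure (hr : 0 < r) : ∫ x, x ^ 2 ∂expMeasure r = 2 / r ^ 2 := by
  have hi : Integrable (fun x : ℝ => 2 * x) (expMeasure r) := by
    simpa using (integrable_pow_expMeasure hr 1).const_mul 2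
  have h := integral_integral_expMeasure hr (f := fun x => 2 * x) (by fun_prop) hi
  rw [← show (∫ u, (∫ v in Set.Ioo 0 u, (2 * v)) ∂expMeasure r) = ∫ x, x ^ 2 ∂expMeasure r from ?_,
    h, integral_const_mul, integral_id_expMeasure hr]
  · field_simp
  · refine integral_congr_ae ?_
    filter_upwards [ae_expMeasure_pos r] with x hx
    rw [← integral_Ioc_eq_integral_Ioo, ← intervalIntegral.integral_of_le hx.le,
      intervalIntegral.integral_const_mul, integral_id]
    ring

/-- Functions of the waiting time `max (y - x) 0` are smooth on `[0, y]` and constant beyond, so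
their means reduce to an explicit antiderivative `A` on `[0, y]`. -/
lemma integral_expMeasure_eq_sub (hr : 0 < r) {y : ℝ} (hy : 0 ≤ y) {f φ A : ℝ → ℝ}
    (hφ : Continuous φ) (hf : ∀ x ≤ y, f x = φ x) (hf0 : ∀ x, y < x → f x = 0)
    (hA : ∀ x, HasDerivAt A (φ x * (r * Real.exp (-(r * x)))) x) :
    ∫ x, f x ∂expMeasure r = A y - A 0 := by
  rw [integral_expMeasure hr, ← intervalIntegral.integral_eq_sub_of_hasDerivAt (fun x _ => hA x)
      (Continuous.intervalIntegrable (by fun_prop) _ _), intervalIntegral.integral_of_le hy,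
    setIntegral_eq_of_subset_of_forall_sdiff_eq_zero measurableSet_Ioi
      (Set.Ioc_subset_Ioi_self : Set.Ioc 0 y ⊆ _)]
  · exact setIntegral_congr_fun measurableSet_Ioc fun x hx => by simp only [hf x hx.2]
  · intro x hx
    have : y < x := by
      by_contra h
      exact hx.2 ⟨hx.1, not_lt.1 h⟩
    simp [hf0 x this]

lemma hasDerivAt_exp_neg_mul (r x : ℝ) :
    HasDerivAt (fun x => Real.exp (-(r * x))) (-(r * Real.exp (-(r * x)))) x := by
  have := ((hasDerivAt_id x).const_mul (-r)).exp
  simp only [id, mul_one, neg_mul] at this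
  exact this.congr_deriv (by ring)

variable {y : ℝ}

/-- This and the next integrals describe one Lindley step from system time `y`: they are the means
entering the Poisson equation, and all lie in the span of `1`, `y`, `y ^ 2`, `exp (-(r * y))` and `y
* exp (-(r * y))`. -/
lemma integral_posPart_expMeasure (hr : 0 < r) (hy : 0 ≤ y) :
    ∫ x, max (y - x) 0 ∂expMeasure r = y - 1 / r + Real.exp (-(r * y)) / r := by
  rw [integral_expMeasure_eq_sub hr hy (φ := fun x => y - x)
    (A := fun x => Real.exp (-(r * x)) * (-(y - x) + 1 / r)) (by fun_prop)
    (fun x hx => max_eq_left (by linarith)) (fun x hx => max_eq_right (by linarith))]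
  · simp; ring
  · intro x
    have h2 : HasDerivAt (fun x : ℝ => -(y - x) + 1 / r) 1 x := by
      simpa using ((hasDerivAt_id x).const_sub y).neg.add_const (1 / r)
    refine ((hasDerivAt_exp_neg_mul r x).mul h2).congr_deriv ?_
    field_simp
    ring

lemma integral_posPart_sq_expMeasure (hr : 0 < r) (hy : 0 ≤ y) :
    ∫ x, (max (y - x) 0) ^ 2 ∂expMeasure r =
      y ^ 2 - 2 * y / r + 2 / r ^ 2 - 2 * Real.exp (-(r * y)) / r ^ 2 := by
  rw [integral_expMeasure_eq_sub hr hy (φ := fun x => (y - x) ^ 2)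
    (A := fun x => Real.exp (-(r * x)) * (-(y - x) ^ 2 + 2 / r * (y - x) - 2 / r ^ 2))
    (by fun_prop) (fun x hx => by rw [max_eq_left (by linarith)])
    (fun x hx => by rw [max_eq_right (by linarith)]; simp)]
  · simp; ring
  · intro x
    have h1 : HasDerivAt (fun x : ℝ => y - x) (-1) x := by
      simpa using (hasDerivAt_id x).const_sub y
    have h2 := ((h1.pow 2).neg.add (h1.const_mul (2 / r))).sub_const (2 / r ^ 2)
    refine ((hasDerivAt_exp_neg_mul r x).mul h2).congr_deriv ?_
    simp
    field_simp
    ring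

lemma integral_mul_posPart_expMeasure (hr : 0 < r) (hy : 0 ≤ y) :
    ∫ x, x * max (y - x) 0 ∂expMeasure r =
      y / r + y * Real.exp (-(r * y)) / r + 2 * Real.exp (-(r * y)) / r ^ 2 - 2 / r ^ 2 := by
  rw [integral_expMeasure_eq_sub hr hy (φ := fun x => x * (y - x))
    (A := fun x => Real.exp (-(r * x)) * (x ^ 2 - y * x - (1 / r) * (y - 2 * x) + 2 / r ^ 2))
    (by fun_prop) (fun x hx => by rw [max_eq_left (by linarith)])
    (fun x hx => by rw [max_eq_right (by linarith)]; simp)]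
  · simp; ring
  · intro x
    have h1 : HasDerivAt (fun x : ℝ => y - 2 * x) (-2) x := by
      simpa using ((hasDerivAt_id x).const_mul 2).const_sub y
    have h2 := ((((hasDerivAt_id x).pow 2).sub ((hasDerivAt_id x).const_mul y)).sub
      (h1.const_mul (1 / r))).add_const (2 / r ^ 2)
    refine ((hasDerivAt_exp_neg_mul r x).mul h2).congr_deriv ?_
    simp
    field_simp
    ring

lemma integrable_exp_posPart_expMeasure (hr : 0 < r) :
    Integrable (fun x => Real.exp (-(r * max (y - x) 0))) (expMeasure r) := by
  have := isProbabilityMeasure_expMeasure hr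
  refine Integrable.of_bound (C := 1) (by fun_prop) (.of_forall fun x => ?_)
  rw [Real.norm_eq_abs, abs_of_pos (Real.exp_pos _), Real.exp_le_one_iff]
  have := mul_nonneg hr.le (le_max_right (y - x) 0)
  linarith

/-- The exponent has the same rate as the law, so the integrand times the density is constant on
`[0, y]`. This resonance produces the term `y * exp (-(r * y))` needed to cancel the one in
`integral_mul_posPart_expMeasure`. -/
lemma integral_exp_posPart_expMeasure (hr : 0 < r) (hy : 0 ≤ y) :
    ∫ x, Real.exp (-(r * max (y - x) 0)) ∂expMeasure r =
      Real.exp (-(r * y)) * (1 + r * y) := by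
  have := isProbabilityMeasure_expMeasure hr
  -- Subtracting `1` makes the integrand vanish for `x > y`.
  have h : ∫ x, (Real.exp (-(r * max (y - x) 0)) - 1) ∂expMeasure r =
      (r * Real.exp (-(r * y)) * y + Real.exp (-(r * y))) -
        (r * Real.exp (-(r * y)) * 0 + Real.exp (-(r * 0))) := by
    refine integral_expMeasure_eq_sub hr hy (φ := fun x => Real.exp (-(r * (y - x))) - 1)
      (A := fun x => r * Real.exp (-(r * y)) * x + Real.exp (-(r * x))) (by fun_prop)
      (fun x hx => by rw [max_eq_left (by linarith)])
      (fun x hx => by rw [max_eq_right (by linarith)]; simp) fun x => ?_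
    refine (((hasDerivAt_id x).const_mul (r * Real.exp (-(r * y)))).add
      (hasDerivAt_exp_neg_mul r x)).congr_deriv ?_
    have e : Real.exp (-(r * (y - x))) * Real.exp (-(r * x)) = Real.exp (-(r * y)) := by
      rw [← Real.exp_add]; ring_nf
    rw [← e]
    ring
  rw [integral_sub (integrable_exp_posPart_expMeasure hr) (integrable_const _)] at h
  simp at h
  linarith

end ExponentialLaw

/-! ### Filtrations generated by independent variables -/

section Past

variable {Ω ι F : Type*} {mΩ : MeasurableSpace Ω} [MeasurableSpace F]

/-- The σ-algebra generated by the variables `V i`, `i ∈ I`. -/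
@[reducible]
def past (V : ι → Ω → ℝ) (I : Set ι) : MeasurableSpace Ω :=
  ⨆ i ∈ I, MeasurableSpace.comap (V i) inferInstance

omit mΩ in
lemma measurable_past (V : ι → Ω → ℝ) {I : Set ι} {i : ι} (hi : i ∈ I) :
    Measurable[past V I] (V i) :=
  Measurable.of_comap_le (le_iSup₂_of_le i hi le_rfl)

/-- The filtration of the information carried by increasing sets of variables. -/
def pastFiltration {V : ι → Ω → ℝ} (hV : ∀ i, Measurable (V i)) {I : ℕ → Set ι}
    (hI : Monotone I) : Filtration ℕ mΩ where
  seq n := past V (I n)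
  mono' _ _ h := biSup_mono (hI h)
  le' _ := iSup₂_le fun i _ => (hV i).comap_le

lemma indep_past {P : Measure Ω} {V : ι → Ω → ℝ} (hV : ∀ i, Measurable (V i))
    (hind : iIndepFun V P) {I J : Set ι} (hIJ : Disjoint I J) {U : Ω → F}
    (hU : Measurable[past V J] U) : Indep (past V I) (MeasurableSpace.comap U inferInstance) P :=
  indep_of_indep_of_le_right (indep_iSup_of_disjoint (fun i => (hV i).comap_le) hind hIJ)
    (Measurable.comap_le hU)

end Past

/-! ### System times and their exponential moments -/

/-- The time that update `n` spends in the system. -/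
def systemTime (x s : ℕ → ℝ) (n : ℕ) : ℝ := departure x s n - epoch x n

lemma systemTime_zero (x s : ℕ → ℝ) : systemTime x s 0 = 0 := by
  simp [systemTime, departure, epoch]

lemma epoch_succ (x : ℕ → ℝ) (n : ℕ) : epoch x (n + 1) = epoch x n + x n := by
  simp [epoch, Finset.sum_range_succ]

/-- Lindley's recursion. -/
lemma systemTime_succ (x s : ℕ → ℝ) (n : ℕ) :
    systemTime x s (n + 1) = max (systemTime x s n - x n) 0 + s n := by
  simp only [systemTime, departure, epoch_succ]
  rw [max_comm, add_sub_right_comm, ← max_sub_sub_right]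
  congr 2 <;> ring

lemma systemTime_nonneg {x s : ℕ → ℝ} (hs : ∀ n, 0 ≤ s n) (n : ℕ) : 0 ≤ systemTime x s n := by
  cases n with
  | zero => exact (systemTime_zero x s).ge
  | succ n => rw [systemTime_succ]; exact add_nonneg (le_max_right _ _) (hs n)

/-- In a stable queue the increments `S - X` have a negative exponential drift. -/
lemma exists_exp_drift {κ : Measure ℝ} [IsProbabilityMeasure κ] (h0 : ∀ᵐ s ∂κ, 0 ≤ s) {t lam : ℝ}
    (hlam : 0 < lam) (ht : 0 < t) (hi : Integrable (fun s => Real.exp (t * s)) κ)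
    (hm : lam * ∫ s, s ∂κ < 1) :
    ∃ θ > 0, Integrable (fun s => Real.exp (θ * s)) κ ∧
      (∫ s, Real.exp (θ * s) ∂κ) * (lam / (lam + θ)) < 1 := by
  have hset : Set.Iic t ⊆ integrableExpSet id κ := by
    intro u hu
    refine (integrable_const 1 |>.add hi).mono' (by fun_prop) ?_
    filter_upwards [h0] with s hs
    rw [Real.norm_eq_abs, abs_of_pos (Real.exp_pos _)]
    have : Real.exp (u * id s) ≤ Real.exp (t * s) :=
      Real.exp_le_exp.2 (mul_le_mul_of_nonneg_right hu hs)
    simp only [Pi.add_apply]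
    linarith
  have hint : (0 : ℝ) ∈ interior (integrableExpSet id κ) :=
    mem_interior.2 ⟨Set.Iio t, Set.Iio_subset_Iic_self.trans hset, isOpen_Iio, ht⟩
  -- The required inequality is `mgf θ < 1 + θ / lam`. Both sides are `1` at `θ = 0`, and stability
  -- says that the left one has the smaller slope there.
  have hd : HasDerivAt (fun θ => mgf id κ θ - θ / lam) (∫ s, s ∂κ - 1 / lam) 0 := by
    have h1 : HasDerivAt (mgf id κ) (∫ s, s ∂κ) 0 := by
      have := (differentiableAt_mgf hint).hasDerivAt
      rwa [deriv_mgf_zero hint] at this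
    exact h1.sub ((hasDerivAt_id (0 : ℝ)).div_const lam)
  have hneg : ∫ s, s ∂κ - 1 / lam < 0 := by
    rw [sub_neg, lt_div_iff₀ hlam]; linarith
  have ev : ∀ᶠ θ in 𝓝[>] (0 : ℝ), 0 < θ ∧ θ < t :=
    eventually_mem_nhdsWithin.and (nhdsWithin_le_nhds (Iio_mem_nhds ht))
  obtain ⟨θ, h1, h2, h3⟩ :=
    ((hd.tendsto_slope_zero_right.eventually (gt_mem_nhds hneg)).and ev).exists
  refine ⟨θ, h2, hset (le_of_lt h3), ?_⟩
  have h4 : mgf id κ θ - θ / lam - 1 < 0 := by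
    have := (mul_neg_iff.1 (show θ⁻¹ * (mgf id κ θ - θ / lam - 1) < 0 by simpa using h1))
    rcases this with h | h
    · exact h.2
    · exact absurd h.1 (not_lt.2 (inv_nonneg.2 h2.le))
  have h5 : mgf id κ θ = ∫ s, Real.exp (θ * s) ∂κ := rfl
  rw [← h5, ← mul_div_assoc, div_lt_one (by positivity)]
  have h6 : mgf id κ θ < 1 + θ / lam := by linarith
  calc mgf id κ θ * lam < (1 + θ / lam) * lam := mul_lt_mul_of_pos_right h6 hlam
    _ = lam + θ := by field_simp

section Chain

variable {Ω : Type*} {mΩ : MeasurableSpace Ω} {P : Measure Ω} [IsProbabilityMeasure P]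
  {X S Z : ℕ → Ω → ℝ} {lam ν : ℝ} {κ : Measure ℝ} [IsProbabilityMeasure κ]

/-- The indices of the variables that determine the system times of the first `n` updates. -/
def arrivalIndices (n : ℕ) : Set (ℕ ⊕ (ℕ ⊕ ℕ)) :=
  Sum.elim (· < n) (Sum.elim (· < n) fun _ => False)

lemma monotone_arrivalIndices : Monotone arrivalIndices := by
  rintro m n h (i | i | i) hi
  · exact lt_of_lt_of_le (show i < m from hi) h
  · exact lt_of_lt_of_le (show i < m from hi) h
  · exact hi

lemma measurable_family (hX : ∀ i, Measurable (X i)) (hS : ∀ i, Measurable (S i))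
    (hZ : ∀ i, Measurable (Z i)) : ∀ i, Measurable (Sum.elim X (Sum.elim S Z) i) := by
  rintro (i | i | i)
  exacts [hX i, hS i, hZ i]

omit mΩ in
lemma measurable_systemTime_past (X S Z : ℕ → Ω → ℝ) (n : ℕ) :
    Measurable[past (Sum.elim X (Sum.elim S Z)) (arrivalIndices n)]
      fun ω => systemTime (fun i => X i ω) (fun i => S i ω) n := by
  -- The σ-algebra stays at level `n` while the induction runs over the earlier system times.
  suffices h : ∀ k ≤ n, Measurable[past (Sum.elim X (Sum.elim S Z)) (arrivalIndices n)]
      fun ω => systemTime (fun i => X i ω) (fun i => S i ω) k from h n le_rfl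
  intro k hk
  induction k with
  | zero => simp only [systemTime_zero]; exact measurable_const
  | succ k ih =>
    have hx := measurable_past (Sum.elim X (Sum.elim S Z)) (I := arrivalIndices n) (i := .inl k) hk
    have hs := measurable_past (Sum.elim X (Sum.elim S Z)) (I := arrivalIndices n)
      (i := .inr (.inl k)) hk
    simp only [Sum.elim_inl, Sum.elim_inr] at hx hs
    simp only [systemTime_succ]
    exact (((ih (by omega)).sub hx).max measurable_const).add hs

omit [IsProbabilityMeasure P] in
lemma indep_past_arrival (hX : ∀ i, Measurable (X i)) (hS : ∀ i, Measurable (S i))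
    (hZ : ∀ i, Measurable (Z i)) (hind : iIndepFun (Sum.elim X (Sum.elim S Z)) P) (n : ℕ) :
    Indep (past (Sum.elim X (Sum.elim S Z)) (arrivalIndices n))
      (MeasurableSpace.comap (fun ω => (X n ω, S n ω)) inferInstance) P := by
  refine indep_past (measurable_family hX hS hZ) hind (J := {.inl n, .inr (.inl n)}) ?_ ?_
  · rw [Set.disjoint_right]
    rintro _ (rfl | rfl) h
    · exact lt_irrefl n h
    · exact lt_irrefl n h
  · have hx := measurable_past (Sum.elim X (Sum.elim S Z)) (I := {.inl n, .inr (.inl n)})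
      (i := .inl n) (by simp)
    have hs := measurable_past (Sum.elim X (Sum.elim S Z)) (I := {.inl n, .inr (.inl n)})
      (i := .inr (.inl n)) (by simp)
    exact hx.prodMk hs

omit [IsProbabilityMeasure κ] in
lemma map_arrival_eq_prod (h : IsMG1M P X S Z lam κ ν) (n : ℕ) :
    P.map (fun ω => (X n ω, S n ω)) = (expMeasure lam).prod κ := by
  have hi : IndepFun (X n) (S n) P :=
    h.indep.indepFun (i := .inl n) (j := .inr (.inl n)) (by simp)
  rw [(indepFun_iff_map_prod_eq_prod_map_map (h.law_interarrival n).aemeasurable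
    (h.law_service n).aemeasurable).1 hi, (h.law_interarrival n).map_eq, (h.law_service n).map_eq]

/-- The system times of a stable queue have uniformly bounded exponential moments. -/
lemma exists_exp_systemTime_bound (h : IsMG1M P X S Z lam κ ν) (hlam : 0 < lam)
    (hX : ∀ i, Measurable (X i)) (hS : ∀ i, Measurable (S i)) (hZ : ∀ i, Measurable (Z i))
    (h0 : ∀ᵐ s ∂κ, 0 ≤ s) {t : ℝ} (ht : 0 < t) (hi : Integrable (fun s => Real.exp (t * s)) κ)
    (hm : lam * ∫ s, s ∂κ < 1) :
    ∃ θ > 0, ∃ B, ∀ n,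
      Integrable (fun ω => Real.exp (θ * systemTime (fun i => X i ω) (fun i => S i ω) n)) P ∧
      ∫ ω, Real.exp (θ * systemTime (fun i => X i ω) (fun i => S i ω) n) ∂P ≤ B := by
  obtain ⟨θ, hθ, hiθ, hr⟩ := exists_exp_drift h0 hlam ht hi hm
  set q := ∫ s, Real.exp (θ * s) ∂κ with hq
  set r := q * (lam / (lam + θ)) with hr_def
  have hq0 : 0 ≤ q := integral_nonneg fun s => (Real.exp_pos _).le
  have hr0 : 0 ≤ r := by positivity
  set T : ℕ → Ω → ℝ := fun n ω => systemTime (fun i => X i ω) (fun i => S i ω) n with hT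
  have hTm : ∀ n, Measurable (T n) := fun n => (measurable_systemTime_past X S Z n).mono
    ((pastFiltration (measurable_family hX hS hZ) monotone_arrivalIndices).le n) le_rfl
  have := isProbabilityMeasure_expMeasure hlam
  have hUm : ∀ n, Measurable fun ω => (X n ω, S n ω) := fun n => (hX n).prodMk (hS n)
  have hstep : ∀ n, Integrable (fun ω => Real.exp (-θ * X n ω) * Real.exp (θ * S n ω)) P ∧
      ∫ ω, Real.exp (-θ * X n ω) * Real.exp (θ * S n ω) ∂P = r := by
    intro n
    have hi' := (integrable_exp_mul_expMeasure hlam (t := -θ) (by linarith)).mul_prod hiθ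
    constructor
    · rw [← map_arrival_eq_prod h n] at hi'
      exact hi'.comp_measurable (hUm n)
    · have e := integral_map (μ := P) (hUm n).aemeasurable
        (f := fun p : ℝ × ℝ => Real.exp (-θ * p.1) * Real.exp (θ * p.2)) (by fun_prop)
      rw [← e, map_arrival_eq_prod h n,
        integral_prod_mul (fun x => Real.exp (-θ * x)) (fun s => Real.exp (θ * s)),
        integral_exp_mul_expMeasure hlam (by linarith), hr_def, hq, sub_neg_eq_add, mul_comm]
  have hSe : ∀ n, Integrable (fun ω => Real.exp (θ * S n ω)) P ∧
      ∫ ω, Real.exp (θ * S n ω) ∂P = q := by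
    intro n
    constructor
    · have := hiθ
      rw [← (h.law_service n).map_eq] at this
      exact this.comp_measurable (hS n)
    · rw [hq, ← (h.law_service n).map_eq,
        integral_map (hS n).aemeasurable (by fun_prop)]
  have hind : ∀ n, IndepFun (fun ω => Real.exp (θ * T n ω))
      (fun ω => Real.exp (-θ * X n ω) * Real.exp (θ * S n ω)) P := by
    intro n
    have h1 := indep_past_arrival hX hS hZ h.indep n
    have h2 : IndepFun (T n) (fun ω => (X n ω, S n ω)) P :=
      indep_of_indep_of_le_left h1 (measurable_systemTime_past X S Z n).comap_le
    exact h2.comp (φ := fun y => Real.exp (θ * y))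
      (ψ := fun p : ℝ × ℝ => Real.exp (-θ * p.1) * Real.exp (θ * p.2)) (by fun_prop) (by fun_prop)
  -- The means `a n` satisfy `a 0 = 1` and `a (n + 1) ≤ r * a n + q`, whose fixed point is `q / (1 -
  -- r)`.
  refine ⟨θ, hθ, 1 + q / (1 - r), fun n => ?_⟩
  induction n with
  | zero =>
    simp only [systemTime_zero, mul_zero, Real.exp_zero]
    refine ⟨integrable_const _, ?_⟩
    have : 0 ≤ q / (1 - r) := div_nonneg hq0 (by linarith)
    simpa using this
  | succ n ih =>
    -- The exponential of the maximum in Lindley's recursion is at most the sum of the exponentials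
    -- of its two alternatives.
    have hle : ∀ ω, Real.exp (θ * T (n + 1) ω) ≤
        Real.exp (θ * T n ω) * (Real.exp (-θ * X n ω) * Real.exp (θ * S n ω)) +
          Real.exp (θ * S n ω) := by
      intro ω
      simp only [hT, systemTime_succ]
      rw [← Real.exp_add, ← Real.exp_add]
      rcases le_total (systemTime (fun i => X i ω) (fun i => S i ω) n - X n ω) 0 with hc | hc
      · rw [max_eq_right hc, zero_add]
        linarith [Real.exp_pos (θ * systemTime (fun i => X i ω) (fun i => S i ω) n +
          (-θ * X n ω + θ * S n ω))]
      · rw [max_eq_left hc]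
        have : θ * (systemTime (fun i => X i ω) (fun i => S i ω) n - X n ω + S n ω) =
          θ * systemTime (fun i => X i ω) (fun i => S i ω) n + (-θ * X n ω + θ * S n ω) := by ring
        rw [this]
        linarith [Real.exp_pos (θ * S n ω)]
    have hi1 : Integrable (fun ω => Real.exp (θ * T n ω) *
        (Real.exp (-θ * X n ω) * Real.exp (θ * S n ω))) P :=
      (hind n).integrable_mul ih.1 (hstep n).1
    have hi2 := hi1.add (hSe n).1
    have hi3 : Integrable (fun ω => Real.exp (θ * T (n + 1) ω)) P := by
      refine hi2.mono' ((hTm (n + 1)).const_mul θ).exp.aestronglyMeasurable (.of_forall fun ω => ?_)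
      rw [Real.norm_eq_abs, abs_of_pos (Real.exp_pos _)]
      exact hle ω
    refine ⟨hi3, ?_⟩
    calc ∫ ω, Real.exp (θ * T (n + 1) ω) ∂P
        ≤ ∫ ω, (Real.exp (θ * T n ω) * (Real.exp (-θ * X n ω) * Real.exp (θ * S n ω)) +
          Real.exp (θ * S n ω)) ∂P := integral_mono hi3 hi2 hle
      _ = (∫ ω, Real.exp (θ * T n ω) ∂P) * r + q := by
          rw [integral_add hi1 (hSe n).1, (hSe n).2, (hind n).integral_fun_mul_eq_mul_integral
            ih.1.aestronglyMeasurable (hstep n).1.aestronglyMeasurable, (hstep n).2]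
      _ ≤ (1 + q / (1 - r)) * r + q := by
          have := mul_le_mul_of_nonneg_right ih.2 hr0
          linarith
      _ ≤ 1 + q / (1 - r) := by
          have h1r : 0 < 1 - r := by linarith
          have : q / (1 - r) * (1 - r) = q := div_mul_cancel₀ _ h1r.ne'
          nlinarith

omit [IsProbabilityMeasure P] in
-- One term of the exponential series gives `(θ T) ^ p / p! ≤ exp (θ T)`.
lemma integral_pow_le_of_exp {θ B : ℝ} (hθ : 0 < θ) {T : Ω → ℝ} (hTm : Measurable T)
    (hT : ∀ᵐ ω ∂P, 0 ≤ T ω) (hi : Integrable (fun ω => Real.exp (θ * T ω)) P)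
    (hB : ∫ ω, Real.exp (θ * T ω) ∂P ≤ B) (p : ℕ) :
    Integrable (fun ω => T ω ^ p) P ∧ ∫ ω, T ω ^ p ∂P ≤ p.factorial / θ ^ p * B := by
  have hle : ∀ᵐ ω ∂P, T ω ^ p ≤ p.factorial / θ ^ p * Real.exp (θ * T ω) := by
    filter_upwards [hT] with ω hω
    have := Real.pow_div_factorial_le_exp (θ * T ω) (by positivity) p
    rw [mul_pow] at this
    rw [div_le_iff₀ (by positivity)] at this
    rw [div_mul_eq_mul_div, le_div_iff₀ (by positivity)]
    linarith
  have hi' := hi.const_mul (p.factorial / θ ^ p)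
  have hint : Integrable (fun ω => T ω ^ p) P := by
    refine hi'.mono' (hTm.pow_const p).aestronglyMeasurable ?_
    filter_upwards [hT, hle] with ω h1 h2
    rwa [Real.norm_eq_abs, abs_of_nonneg (pow_nonneg h1 p)]
  refine ⟨hint, (integral_mono_ae hint hi' hle).trans ?_⟩
  rw [integral_const_mul]
  exact mul_le_mul_of_nonneg_left hB (by positivity)

end Chain

/-! ### Poisson equation for the area under the age curve -/

/-- The mean area under the age curve per update, for Poisson arrivals of rate `lam` and service
law `κ`; `lam` times it is the average age. -/
noncomputable def areaPerUpdate (lam : ℝ) (κ : Measure ℝ) : ℝ :=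
  (∫ s, s ∂κ + lam * (∫ s, s ^ 2 ∂κ) / (2 * (1 - lam * ∫ s, s ∂κ)) +
    (1 - lam * ∫ s, s ∂κ) / (lam * ∫ s, Real.exp (-(lam * s)) ∂κ)) / lam

/-- The function `α y + β y ^ 2 + γ exp (- lam y)` of the system time. -/
noncomputable def potential (lam α β γ y : ℝ) : ℝ := α * y + β * y ^ 2 + γ * Real.exp (-(lam * y))

/-- The area under the age curve contributed by one update, corrected by the increment of the
potential of the system time. -/
noncomputable def areaIncrement (lam α β γ c : ℝ) (p : ℝ × ℝ × ℝ) : ℝ :=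
  p.2.1 ^ 2 / 2 + p.2.1 * (max (p.1 - p.2.1) 0 + p.2.2) +
    potential lam α β γ (max (p.1 - p.2.1) 0 + p.2.2) - potential lam α β γ p.1 - c

lemma measurable_areaIncrement (lam α β γ c : ℝ) : Measurable (areaIncrement lam α β γ c) := by
  unfold areaIncrement potential
  fun_prop

/-- Quadratic growth makes the potential negligible against `n` along typical paths and lets fourth
moments control squared increments. -/
lemma abs_potential_le {lam : ℝ} (hlam : 0 < lam) (α β γ : ℝ) {y : ℝ} (hy : 0 ≤ y) :
    |potential lam α β γ y| ≤ (|α| + |β| + |γ|) * (1 + y ^ 2) := by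
  have h1 : |Real.exp (-(lam * y))| ≤ 1 := by
    rw [abs_of_pos (Real.exp_pos _), Real.exp_le_one_iff]
    nlinarith
  have h2 : |α * y| ≤ |α| * (1 + y ^ 2) := by
    rw [abs_mul, abs_of_nonneg hy]
    exact mul_le_mul_of_nonneg_left (by nlinarith [sq_nonneg (y - 1)]) (abs_nonneg _)
  have h3 : |β * y ^ 2| ≤ |β| * (1 + y ^ 2) := by
    rw [abs_mul, abs_of_nonneg (sq_nonneg y)]
    exact mul_le_mul_of_nonneg_left (by linarith) (abs_nonneg _)
  have h4 : |γ * Real.exp (-(lam * y))| ≤ |γ| * (1 + y ^ 2) := by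
    rw [abs_mul]
    exact mul_le_mul_of_nonneg_left (by nlinarith [sq_nonneg y]) (abs_nonneg _)
  have := abs_add_three (α * y) (β * y ^ 2) (γ * Real.exp (-(lam * y)))
  unfold potential
  linarith

lemma areaIncrement_sq_le {lam : ℝ} (hlam : 0 < lam) (α β γ c : ℝ) :
    ∃ K, ∀ y x s : ℝ, 0 ≤ y → 0 ≤ x → 0 ≤ s →
      areaIncrement lam α β γ c (y, x, s) ^ 2 ≤ K * (1 + y ^ 4 + x ^ 4 + s ^ 4) := by
  set k := |α| + |β| + |γ| with hk
  have hk0 : 0 ≤ k := by positivity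
  -- With `R = 1 + y ^ 2 + x ^ 2 + s ^ 2`, the area costs `3 R`, the new and old potentials cost `2
  -- k R` and `k R`, and `c` costs `|c| R`. The factor `4` comes from Cauchy–Schwarz applied to `R ^
  -- 2`.
  refine ⟨4 * (3 + 3 * k + |c|) ^ 2, fun y x s hy hx hs => ?_⟩
  have hm0 : 0 ≤ max (y - x) 0 := le_max_right _ _
  have hmy : max (y - x) 0 ≤ y := max_le (by linarith) hy
  set m := max (y - x) 0
  have hp1 := abs_potential_le hlam α β γ (add_nonneg hm0 hs)
  have hp2 := abs_potential_le hlam α β γ hy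
  rw [← hk] at hp1 hp2
  have hms : 1 + (m + s) ^ 2 ≤ 2 * (1 + y ^ 2 + x ^ 2 + s ^ 2) := by
    nlinarith [sq_nonneg (m - s), sq_nonneg x]
  have hy2 : 1 + y ^ 2 ≤ 1 + y ^ 2 + x ^ 2 + s ^ 2 := by nlinarith [sq_nonneg x, sq_nonneg s]
  have hxm : x ^ 2 / 2 + x * (m + s) ≤ 3 * (1 + y ^ 2 + x ^ 2 + s ^ 2) := by
    nlinarith [sq_nonneg (x - m), sq_nonneg (x - s)]
  have hxm0 : 0 ≤ x ^ 2 / 2 + x * (m + s) := by positivity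
  have hR : 1 ≤ 1 + y ^ 2 + x ^ 2 + s ^ 2 := by nlinarith [sq_nonneg x, sq_nonneg s, sq_nonneg y]
  have hp1' := hp1.trans (mul_le_mul_of_nonneg_left hms hk0)
  have hp2' := hp2.trans (mul_le_mul_of_nonneg_left hy2 hk0)
  set R := 1 + y ^ 2 + x ^ 2 + s ^ 2
  have hc : |c| ≤ |c| * R := le_mul_of_one_le_right (abs_nonneg _) hR
  have habs : |areaIncrement lam α β γ c (y, x, s)| ≤ (3 + 3 * k + |c|) * R := by
    have e : areaIncrement lam α β γ c (y, x, s) = x ^ 2 / 2 + x * (m + s) +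
      potential lam α β γ (m + s) - potential lam α β γ y - c := rfl
    rw [e, abs_le]
    have a1 := abs_le.1 hp1'
    have a2 := abs_le.1 hp2'
    have a3 := abs_le.1 (le_refl |c|)
    constructor <;> nlinarith
  calc areaIncrement lam α β γ c (y, x, s) ^ 2
      = |areaIncrement lam α β γ c (y, x, s)| ^ 2 := (sq_abs _).symm
    _ ≤ ((3 + 3 * k + |c|) * R) ^ 2 := pow_le_pow_left₀ (abs_nonneg _) habs 2
    _ = (3 + 3 * k + |c|) ^ 2 * R ^ 2 := mul_pow _ _ _
    _ ≤ (3 + 3 * k + |c|) ^ 2 * (4 * (1 + y ^ 4 + x ^ 4 + s ^ 4)) := by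
        refine mul_le_mul_of_nonneg_left ?_ (sq_nonneg _)
        simp only [R]
        nlinarith [sq_nonneg (y ^ 2 - x ^ 2), sq_nonneg (y ^ 2 - s ^ 2), sq_nonneg (x ^ 2 - s ^ 2),
          sq_nonneg (y ^ 2 - 1), sq_nonneg (x ^ 2 - 1), sq_nonneg (s ^ 2 - 1)]
    _ = _ := by ring

/-- The Poisson equation for the area under the age curve. -/
lemma integral_areaIncrement_eq_zero {lam : ℝ} (hlam : 0 < lam) {κ : Measure ℝ}
    [IsProbabilityMeasure κ] (h0 : ∀ᵐ s ∂κ, 0 ≤ s) (hi1 : Integrable (fun s => s) κ)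
    (hi2 : Integrable (fun s => s ^ 2) κ) (hm : lam * ∫ s, s ∂κ < 1) :
    ∃ α β γ, ∀ y, 0 ≤ y → ∫ p, areaIncrement lam α β γ (areaPerUpdate lam κ) (y, p)
      ∂((expMeasure lam).prod κ) = 0 := by
  have := isProbabilityMeasure_expMeasure hlam
  have hiG : Integrable (fun s => Real.exp (-(lam * s))) κ := by
    refine Integrable.of_bound (C := 1) (by fun_prop) ?_
    filter_upwards [h0] with s hs
    rw [Real.norm_eq_abs, abs_of_pos (Real.exp_pos _), Real.exp_le_one_iff]
    nlinarith
  have hG : 0 < ∫ s, Real.exp (-(lam * s)) ∂κ := integral_exp_pos hiG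
  unfold areaPerUpdate
  set m1 := ∫ s, s ∂κ
  set m2 := ∫ s, s ^ 2 ∂κ
  set G := ∫ s, Real.exp (-(lam * s)) ∂κ
  -- The coefficients of `y`, of `y * exp (-(lam * y))` and of `exp (-(lam * y))` in the mean
  -- increment must vanish; they determine `β`, `γ` and `α` in this order. The constant term is then
  -- `areaPerUpdate`.
  set β : ℝ := 1 / (2 * (1 - lam * m1)) with hβ
  set γ : ℝ := -(1 / (lam ^ 2 * G)) with hγ
  set α : ℝ := -lam * (1 / lam ^ 2 + γ * (G - 1)) with hα
  refine ⟨α, β, γ, fun y hy => ?_⟩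
  set c : ℝ := (m1 + lam * m2 / (2 * (1 - lam * m1)) + (1 - lam * m1) / (lam * G)) / lam with hc
  set M : ℝ → ℝ := fun x => max (y - x) 0 with hM
  have hMm : Measurable M := by fun_prop
  have hx0 : ∀ᵐ x ∂expMeasure lam, 0 < x := ae_expMeasure_pos lam
  have hMb : ∀ x, 0 < x → |M x| ≤ y := fun x hx => by
    rw [abs_of_nonneg (le_max_right _ _)]
    exact max_le (by linarith) hy
  have iM : Integrable M (expMeasure lam) :=
    Integrable.of_bound (C := y) hMm.aestronglyMeasurable (hx0.mono fun x hx => hMb x hx)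
  have iM2 : Integrable (fun x => M x ^ 2) (expMeasure lam) := by
    refine Integrable.of_bound (C := y ^ 2) (hMm.pow_const 2).aestronglyMeasurable
      (hx0.mono fun x hx => ?_)
    rw [norm_pow]
    exact pow_le_pow_left₀ (norm_nonneg _) (hMb x hx) 2
  have ix : Integrable (fun x : ℝ => x) (expMeasure lam) := by
    simpa using integrable_pow_expMeasure hlam 1
  have ix2 : Integrable (fun x : ℝ => x ^ 2) (expMeasure lam) := integrable_pow_expMeasure hlam 2
  have ixM : Integrable (fun x => x * M x) (expMeasure lam) := by
    refine (ix.mul_const y).mono' (measurable_id.mul hMm).aestronglyMeasurable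
      (hx0.mono fun x hx => ?_)
    rw [norm_mul, Real.norm_of_nonneg hx.le]
    exact mul_le_mul_of_nonneg_left (hMb x hx) hx.le
  have iE : Integrable (fun x => Real.exp (-(lam * M x))) (expMeasure lam) :=
    integrable_exp_posPart_expMeasure hlam
  have e : ∀ p : ℝ × ℝ, areaIncrement lam α β γ c (y, p) =
      ((p.1 ^ 2 / 2 + p.1 * M p.1 + α * M p.1 + β * M p.1 ^ 2) * 1 +
      (p.1 + 2 * β * M p.1) * p.2 + 1 * (α * p.2 + β * p.2 ^ 2) +
      γ * (Real.exp (-(lam * M p.1)) * Real.exp (-(lam * p.2)))) -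
        (α * y + β * y ^ 2 + γ * Real.exp (-(lam * y)) + c) := by
    intro p
    simp only [areaIncrement, potential, hM]
    rw [← Real.exp_add]
    ring_nf
  have ia : Integrable (fun x => x ^ 2 / 2 + x * M x + α * M x + β * M x ^ 2) (expMeasure lam) :=
    (((ix2.div_const 2).add ixM).add (iM.const_mul α)).add (iM2.const_mul β)
  have ib : Integrable (fun x => x + 2 * β * M x) (expMeasure lam) := ix.add (iM.const_mul _)
  have ic : Integrable (fun s => α * s + β * s ^ 2) κ := (hi1.const_mul α).add (hi2.const_mul β)
  have j1 := ia.mul_prod (integrable_const (μ := κ) (1 : ℝ))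
  have j2 := ib.mul_prod hi1
  have j3 := (integrable_const (μ := expMeasure lam) (1 : ℝ)).mul_prod ic
  have j4 := (iE.mul_prod hiG).const_mul γ
  have va : ∫ x, (x ^ 2 / 2 + x * M x + α * M x + β * M x ^ 2) ∂expMeasure lam =
      1 / lam ^ 2 + (∫ x, x * M x ∂expMeasure lam) + α * (∫ x, M x ∂expMeasure lam) +
        β * ∫ x, M x ^ 2 ∂expMeasure lam := by
    have k1 : Integrable (fun x => x ^ 2 / 2 + x * M x) (expMeasure lam) :=
      (ix2.div_const 2).add ixM
    have k2 : Integrable (fun x => x ^ 2 / 2 + x * M x + α * M x) (expMeasure lam) :=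
      k1.add (iM.const_mul α)
    rw [integral_add k2 (iM2.const_mul β), integral_add k1 (iM.const_mul α),
      integral_add (ix2.div_const 2) ixM, integral_div, integral_sq_expMeasure hlam,
      integral_const_mul, integral_const_mul]
    ring
  have vb : ∫ x, (x + 2 * β * M x) ∂expMeasure lam =
      1 / lam + 2 * β * ∫ x, M x ∂expMeasure lam := by
    rw [integral_add ix (iM.const_mul _), integral_const_mul, integral_id_expMeasure hlam]
  have vc : ∫ s, (α * s + β * s ^ 2) ∂κ = α * m1 + β * m2 := by
    rw [integral_add (hi1.const_mul α) (hi2.const_mul β), integral_const_mul, integral_const_mul]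
  have j12 : Integrable (fun p : ℝ × ℝ =>
      (p.1 ^ 2 / 2 + p.1 * M p.1 + α * M p.1 + β * M p.1 ^ 2) * 1 +
      (p.1 + 2 * β * M p.1) * p.2) ((expMeasure lam).prod κ) := j1.add j2
  have j123 : Integrable (fun p : ℝ × ℝ =>
      (p.1 ^ 2 / 2 + p.1 * M p.1 + α * M p.1 + β * M p.1 ^ 2) * 1 +
      (p.1 + 2 * β * M p.1) * p.2 + 1 * (α * p.2 + β * p.2 ^ 2)) ((expMeasure lam).prod κ) :=
    j12.add j3
  have j1234 : Integrable (fun p : ℝ × ℝ =>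
      (p.1 ^ 2 / 2 + p.1 * M p.1 + α * M p.1 + β * M p.1 ^ 2) * 1 +
      (p.1 + 2 * β * M p.1) * p.2 + 1 * (α * p.2 + β * p.2 ^ 2) +
      γ * (Real.exp (-(lam * M p.1)) * Real.exp (-(lam * p.2)))) ((expMeasure lam).prod κ) :=
    j123.add j4
  have v4 : ∫ p : ℝ × ℝ, γ * (Real.exp (-(lam * M p.1)) * Real.exp (-(lam * p.2)))
      ∂((expMeasure lam).prod κ) = γ * ((∫ x, Real.exp (-(lam * M x)) ∂expMeasure lam) * G) := by
    rw [integral_const_mul,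
      integral_prod_mul (fun x => Real.exp (-(lam * M x))) (fun s => Real.exp (-(lam * s)))]
  simp_rw [e]
  rw [integral_sub j1234 (integrable_const _), integral_add j123 j4, integral_add j12 j3,
    integral_add j1 j2, v4,
    integral_prod_mul (fun x => x ^ 2 / 2 + x * M x + α * M x + β * M x ^ 2) (fun _ => (1 : ℝ)),
    integral_prod_mul (fun x => x + 2 * β * M x) (fun s => s),
    integral_prod_mul (fun _ => (1 : ℝ)) (fun s => α * s + β * s ^ 2),
    va, vb, vc]
  simp only [integral_const, probReal_univ, smul_eq_mul, one_mul, mul_one]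
  rw [integral_mul_posPart_expMeasure hlam hy, integral_posPart_expMeasure hlam hy,
    integral_posPart_sq_expMeasure hlam hy, integral_exp_posPart_expMeasure hlam hy]
  change _ + (1 / lam + 2 * β * _) * m1 + _ + _ - _ = 0
  have hρ : 1 - lam * m1 ≠ 0 := by linarith
  have hl : lam ≠ 0 := hlam.ne'
  have hG' : G ≠ 0 := hG.ne'
  rw [hα, hc, hβ, hγ]
  field_simp
  ring

/-! ### Typical paths of the queue -/

/-- The properties of typical arrival and service processes that determine the long-run behaviour
of the age. -/
structure IsRegularPath (x s : ℕ → ℝ) (lam c : ℝ) : Prop where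
  interarrival_nonneg : ∀ n, 0 ≤ x n
  service_nonneg : ∀ n, 0 ≤ s n
  tendsto_epoch : Tendsto (fun n : ℕ => epoch x n / n) atTop (𝓝 (1 / lam))
  systemTime_growth : ∃ C, ∀ n : ℕ, systemTime x s n ^ 4 ≤ C * (n + 1)
  interarrival_growth : ∃ C, ∀ n : ℕ, x n ^ 4 ≤ C * (n + 1)
  tendsto_area : Tendsto (fun n : ℕ =>
    (∑ k ∈ Finset.range n, (x k ^ 2 / 2 + x k * systemTime x s (k + 1))) / (n : ℝ)) atTop (𝓝 c)

lemma tendsto_sq_div_of_pow_four_le {T : ℕ → ℝ} {C : ℝ} (h : ∀ n : ℕ, T n ^ 4 ≤ C * (n + 1)) :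
    Tendsto (fun n : ℕ => T n ^ 2 / n) atTop (𝓝 0) := by
  have h1 : Tendsto (fun n : ℕ => Real.sqrt (C * (1 / (n : ℝ) + 1 / (n : ℝ) * (1 / n))))
      atTop (𝓝 0) := by
    have h0 := tendsto_one_div_atTop_nhds_zero_nat (𝕜 := ℝ)
    have := ((h0.add (h0.mul h0)).const_mul C).sqrt
    simpa using this
  refine squeeze_zero' (.of_forall fun n => by positivity) ?_ h1
  filter_upwards [eventually_gt_atTop 0] with n hn
  have hn' : (0 : ℝ) < n := by exact_mod_cast hn
  refine Real.le_sqrt_of_sq_le ?_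
  rw [div_pow, div_le_iff₀ (by positivity)]
  calc (T n ^ 2) ^ 2 = T n ^ 4 := by ring
    _ ≤ C * (n + 1) := h n
    _ = _ := by field_simp

section Chain

variable {Ω : Type*} {mΩ : MeasurableSpace Ω} {P : Measure Ω} [IsProbabilityMeasure P]
  {X S Z : ℕ → Ω → ℝ} {lam ν : ℝ} {κ : Measure ℝ} [IsProbabilityMeasure κ]

omit [IsProbabilityMeasure P] in
lemma ae_of_hasLaw {X : Ω → ℝ} {κ : Measure ℝ} (h : HasLaw X κ P) {p : ℝ → Prop}
    (hp : ∀ᵐ x ∂κ, p x) : ∀ᵐ ω ∂P, p (X ω) := by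
  rw [← h.map_eq] at hp
  exact ae_of_ae_map h.aemeasurable hp

omit [IsProbabilityMeasure P] in
lemma pow_of_hasLaw {X : Ω → ℝ} {κ : Measure ℝ} (h : HasLaw X κ P) (n : ℕ)
    (hi : Integrable (fun x => x ^ n) κ) :
    Integrable (fun ω => X ω ^ n) P ∧ ∫ ω, X ω ^ n ∂P = ∫ x, x ^ n ∂κ := by
  constructor
  · rw [← h.map_eq] at hi
    exact hi.comp_aemeasurable h.aemeasurable
  · rw [← h.map_eq, integral_map h.aemeasurable (by fun_prop)]

omit [IsProbabilityMeasure P] in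
/-- The strong law of large numbers for the epochs of a Poisson process. -/
lemma ae_tendsto_epoch {V : ℕ → Ω → ℝ} {r : ℝ} (hr : 0 < r) (hV : ∀ i, HasLaw (V i) (expMeasure r) P)
    (hind : Pairwise fun i j => IndepFun (V i) (V j) P) :
    ∀ᵐ ω ∂P, Tendsto (fun n : ℕ => epoch (fun i => V i ω) n / n) atTop (𝓝 (1 / r)) := by
  have hi := pow_of_hasLaw (hV 0) 1 (integrable_pow_expMeasure hr 1)
  simp only [pow_one] at hi
  have := strong_law_ae_real V hi.1 hind fun i =>
    ⟨(hV i).aemeasurable, (hV 0).aemeasurable, by rw [(hV i).map_eq, (hV 0).map_eq]⟩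
  rw [hi.2, integral_id_expMeasure hr] at this
  exact this

/-- The growth conditions follow from uniform eighth moments. For the areas, the strong law kills
the average of `areaIncrement`, the potential telescopes to a negligible boundary term, and the
centring constant remains. -/
theorem ae_isRegularPath (h : IsMG1M P X S Z lam κ ν) (hlam : 0 < lam)
    (hX : ∀ i, Measurable (X i)) (hS : ∀ i, Measurable (S i)) (hZ : ∀ i, Measurable (Z i))
    (h0 : ∀ᵐ s ∂κ, 0 ≤ s) {t : ℝ} (ht : 0 < t) (hi : Integrable (fun s => Real.exp (t * s)) κ)
    (hm : lam * ∫ s, s ∂κ < 1) :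
    ∀ᵐ ω ∂P, IsRegularPath (fun i => X i ω) (fun i => S i ω) lam (areaPerUpdate lam κ) := by
  set T : ℕ → Ω → ℝ := fun n ω => systemTime (fun i => X i ω) (fun i => S i ω) n with hT
  have hTm : ∀ n, Measurable (T n) := fun n => (measurable_systemTime_past X S Z n).mono
    ((pastFiltration (measurable_family hX hS hZ) monotone_arrivalIndices).le n) le_rfl
  have hX0 : ∀ᵐ ω ∂P, ∀ n, 0 ≤ X n ω := ae_all_iff.2 fun n =>
    ae_of_hasLaw (h.law_interarrival n) ((ae_expMeasure_pos lam).mono fun _ h => h.le)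
  have hS0 : ∀ᵐ ω ∂P, ∀ n, 0 ≤ S n ω := ae_all_iff.2 fun n => ae_of_hasLaw (h.law_service n) h0
  have hT0 : ∀ᵐ ω ∂P, ∀ n, 0 ≤ T n ω := hS0.mono fun ω hω n => systemTime_nonneg hω n
  obtain ⟨θ, hθ, B, hB⟩ := exists_exp_systemTime_bound h hlam hX hS hZ h0 ht hi hm
  have hTp : ∀ p n, Integrable (fun ω => T n ω ^ p) P ∧
      ∫ ω, T n ω ^ p ∂P ≤ p.factorial / θ ^ p * B := fun p n =>
    integral_pow_le_of_exp hθ (hTm n) (hT0.mono fun _ h => h n) (hB n).1 (hB n).2 p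
  have hXp : ∀ p n, _ := fun p n => pow_of_hasLaw (h.law_interarrival n) p
    (integrable_pow_expMeasure hlam p)
  have hSp : ∀ p n, _ := fun p n => pow_of_hasLaw (h.law_service n) p
    (integrable_pow_of_exp h0 ht hi p)
  have hgT : ∀ᵐ ω ∂P, ∃ C, ∀ n : ℕ, T n ω ^ 4 ≤ C * (n + 1) := by
    refine ae_exists_le_of_integral_sq_le (V := fun n ω => T n ω ^ 4)
      (B := (8).factorial / θ ^ 8 * B) (fun n => ?_) fun n => ?_
    · simpa only [← pow_mul] using (hTp 8 n).1
    · simpa only [← pow_mul] using (hTp 8 n).2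
  have hgX : ∀ᵐ ω ∂P, ∃ C, ∀ n : ℕ, X n ω ^ 4 ≤ C * (n + 1) := by
    refine ae_exists_le_of_integral_sq_le (V := fun n ω => X n ω ^ 4)
      (B := ∫ x, x ^ 8 ∂expMeasure lam) (fun n => ?_) fun n => ?_
    · simpa only [← pow_mul] using (hXp 8 n).1
    · simpa only [← pow_mul] using (hXp 8 n).2.le
  obtain ⟨α, β, γ, hz⟩ := integral_areaIncrement_eq_zero hlam h0
    (by simpa using integrable_pow_of_exp h0 ht hi 1) (integrable_pow_of_exp h0 ht hi 2) hm
  set c := areaPerUpdate lam κ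
  obtain ⟨K, hK⟩ := areaIncrement_sq_le hlam α β γ c
  have hgm := measurable_areaIncrement lam α β γ c
  have hdom : ∀ n, Integrable (fun ω => K * (1 + T n ω ^ 4 + X n ω ^ 4 + S n ω ^ 4)) P := fun n =>
    ((((integrable_const 1).add (hTp 4 n).1).add (hXp 4 n).1).add (hSp 4 n).1).const_mul K
  have hle : ∀ n, ∀ᵐ ω ∂P, areaIncrement lam α β γ c (T n ω, X n ω, S n ω) ^ 2 ≤
      K * (1 + T n ω ^ 4 + X n ω ^ 4 + S n ω ^ 4) := fun n => by
    filter_upwards [hT0, hX0, hS0] with ω h1 h2 h3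
    exact hK _ _ _ (h1 n) (h2 n) (h3 n)
  have hK0 : 0 ≤ K := by
    have := (sq_nonneg _).trans (hK 0 0 0 le_rfl le_rfl le_rfl)
    simpa using this
  have hint : ∀ n, Integrable (fun ω => areaIncrement lam α β γ c (T n ω, X n ω, S n ω) ^ 2) P := by
    intro n
    refine (hdom n).mono' ((hgm.comp ((hTm n).prodMk ((hX n).prodMk (hS n)))).pow_const
      2).aestronglyMeasurable ?_
    filter_upwards [hle n] with ω hω
    rwa [Real.norm_eq_abs, abs_of_nonneg (sq_nonneg _)]
  set A := K * (1 + (4).factorial / θ ^ 4 * B + (∫ x, x ^ 4 ∂expMeasure lam) + ∫ s, s ^ 4 ∂κ)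
  have hA : ∀ n, ∫ ω, areaIncrement lam α β γ c (T n ω, X n ω, S n ω) ^ 2 ∂P ≤ A := by
    intro n
    refine (integral_mono_ae (hint n) (hdom n) (hle n)).trans ?_
    have i1 : Integrable (fun ω => 1 + T n ω ^ 4) P := (integrable_const 1).add (hTp 4 n).1
    have i2 : Integrable (fun ω => 1 + T n ω ^ 4 + X n ω ^ 4) P := i1.add (hXp 4 n).1
    rw [integral_const_mul, integral_add i2 (hSp 4 n).1, integral_add i1 (hXp 4 n).1,
      integral_add (integrable_const 1) (hTp 4 n).1, (hXp 4 n).2, (hSp 4 n).2]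
    refine mul_le_mul_of_nonneg_left ?_ hK0
    have := (hTp 4 n).2
    simp only [integral_const, probReal_univ, smul_eq_mul, one_mul]
    linarith
  have hsum : Summable fun n : ℕ => A / ((n : ℝ) + 1) ^ 2 := by
    have := ((summable_nat_add_iff 1).2 (Real.summable_one_div_nat_pow.2 one_lt_two)).mul_left A
    simpa [div_eq_mul_inv] using this
  have hslln := ae_tendsto_average_zero_of_indep (P := P)
    (pastFiltration (measurable_family hX hS hZ) monotone_arrivalIndices)
    (Y := T) (U := fun n ω => (X n ω, S n ω)) (g := areaIncrement lam α β γ c) (b := fun _ => A)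
    (fun n => measurable_systemTime_past X S Z n)
    (fun n => (measurable_past (Sum.elim X (Sum.elim S Z)) (I := arrivalIndices (n + 1))
      (i := .inl n) n.lt_succ_self).prodMk (measurable_past (Sum.elim X (Sum.elim S Z))
      (I := arrivalIndices (n + 1)) (i := .inr (.inl n)) n.lt_succ_self))
    (fun n => indep_past_arrival hX hS hZ h.indep n) hgm
    (fun n => hT0.mono fun ω hω => by rw [map_arrival_eq_prod h n]; exact hz _ (hω n))
    hint hA hsum
  have hepoch := ae_tendsto_epoch hlam h.law_interarrival fun i j hij =>
    h.indep.indepFun (i := .inl i) (j := .inl j) (by simpa using hij)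
  filter_upwards [hX0, hS0, hT0, hgT, hgX, hslln, hepoch] with ω h1 h2 h3 h4 h5 h6 h7
  refine ⟨h1, h2, h7, h4, h5, ?_⟩
  obtain ⟨C, hC⟩ := h4
  have hsq := tendsto_sq_div_of_pow_four_le hC
  have hpot : Tendsto (fun n : ℕ => potential lam α β γ (T n ω) / n) atTop (𝓝 0) := by
    have hlim : Tendsto (fun n : ℕ => (|α| + |β| + |γ|) * (1 / (n : ℝ) + T n ω ^ 2 / n))
        atTop (𝓝 0) := by
      have := ((tendsto_one_div_atTop_nhds_zero_nat (𝕜 := ℝ)).add hsq).const_mul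
        (|α| + |β| + |γ|)
      simpa using this
    refine squeeze_zero_norm (fun n => ?_) hlim
    rw [norm_div, Real.norm_eq_abs, Real.norm_natCast, ← add_div, ← mul_div_assoc]
    exact div_le_div_of_nonneg_right (abs_potential_le hlam α β γ (h3 n)) (Nat.cast_nonneg n)
  -- By Lindley's recursion the two potentials in an increment are those of consecutive system
  -- times.
  have hsumeq : ∀ n : ℕ, ∑ k ∈ Finset.range n, areaIncrement lam α β γ c (T k ω, X k ω, S k ω) =
      ∑ k ∈ Finset.range n, (X k ω ^ 2 / 2 + X k ω * T (k + 1) ω) +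
        potential lam α β γ (T n ω) - potential lam α β γ (T 0 ω) - n * c := by
    intro n
    induction n with
    | zero => simp
    | succ n ih =>
      rw [Finset.sum_range_succ, Finset.sum_range_succ, ih]
      have e : T (n + 1) ω = max (T n ω - X n ω) 0 + S n ω := systemTime_succ _ _ n
      simp only [areaIncrement, e]
      push_cast
      ring
  have hconst : Tendsto (fun n : ℕ => potential lam α β γ (T 0 ω) / (n : ℝ)) atTop (𝓝 0) :=
    tendsto_const_div_atTop_nhds_zero_nat _
  have := ((h6.sub hpot).add hconst).add_const c
  rw [sub_zero, add_zero, zero_add] at this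
  refine this.congr' ?_
  filter_upwards [eventually_gt_atTop 0] with n hn
  have hn' : (n : ℝ) ≠ 0 := by positivity
  rw [hsumeq]
  field_simp
  ring

end Chain

/-! ### Time average of the age along a typical path -/

lemma epoch_mono {x : ℕ → ℝ} (hx : ∀ n, 0 ≤ x n) : Monotone (epoch x) :=
  monotone_nat_of_le_succ fun n => by rw [epoch_succ]; linarith [hx n]

lemma departure_mono {x s : ℕ → ℝ} (hs : ∀ n, 0 ≤ s n) : Monotone (departure x s) :=
  monotone_nat_of_le_succ fun n => by
    rw [departure]
    linarith [hs n, le_max_right (epoch x (n + 1)) (departure x s n)]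

lemma lastReceived_eq {x s : ℕ → ℝ} (hs : ∀ n, 0 ≤ s n) {t : ℝ} {k : ℕ}
    (h1 : departure x s k ≤ t) (h2 : t < departure x s (k + 1)) : lastReceived x s t = k := by
  refine IsGreatest.csSup_eq ⟨h1, fun j hj => ?_⟩
  by_contra hjk
  have hmono := departure_mono (x := x) hs (show k + 1 ≤ j by omega)
  have hj : departure x s j ≤ t := hj
  linarith

lemma departure_eq (x s : ℕ → ℝ) (n : ℕ) : departure x s n = epoch x n + systemTime x s n := by
  simp [systemTime]

namespace IsRegularPath

variable {x s : ℕ → ℝ} {lam c : ℝ} (h : IsRegularPath x s lam c)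
include h

lemma tendsto_departure_div :
    Tendsto (fun n : ℕ => departure x s n / n) atTop (𝓝 (1 / lam)) := by
  obtain ⟨C, hC⟩ := h.systemTime_growth
  have hsq := tendsto_sq_div_of_pow_four_le hC
  have hT : Tendsto (fun n : ℕ => systemTime x s n / n) atTop (𝓝 0) := by
    have hlim := (tendsto_one_div_atTop_nhds_zero_nat (𝕜 := ℝ)).add hsq
    rw [add_zero] at hlim
    refine squeeze_zero (fun n => div_nonneg (systemTime_nonneg h.service_nonneg n)
      (Nat.cast_nonneg n)) (fun n => ?_) hlim
    rw [← add_div]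
    exact div_le_div_of_nonneg_right
      (by nlinarith [sq_nonneg (systemTime x s n - 1)]) (Nat.cast_nonneg n)
  have := h.tendsto_epoch.add hT
  rw [add_zero] at this
  exact this.congr fun n => by rw [departure_eq, add_div]

lemma tendsto_departure (hlam : 0 < lam) : Tendsto (departure x s) atTop atTop := by
  have := h.tendsto_departure_div.pos_mul_atTop (one_div_pos.2 hlam)
    (tendsto_natCast_atTop_atTop (R := ℝ))
  refine this.congr' ?_
  filter_upwards [eventually_gt_atTop 0] with n hn
  have hn' : (n : ℝ) ≠ 0 := by positivity
  field_simp

/-- Since departures tend to infinity, the set in `lastReceived` is bounded, and its supremum is not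
the default value `0` of an unbounded set. -/
lemma lastReceived_spec (hlam : 0 < lam) {t : ℝ} (ht : 0 ≤ t) :
    departure x s (lastReceived x s t) ≤ t ∧ t < departure x s (lastReceived x s t + 1) := by
  classical
  have hex : ∃ n, t < departure x s n :=
    ((h.tendsto_departure hlam).eventually_gt_atTop t).exists
  obtain ⟨k, hk⟩ : ∃ k, Nat.find hex = k + 1 := by
    refine Nat.exists_eq_succ_of_ne_zero fun h0 => ?_
    have := Nat.find_spec hex
    rw [h0, departure] at this
    linarith
  have h1 : departure x s k ≤ t := not_lt.1 (Nat.find_min hex (by omega))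
  have h2 : t < departure x s (k + 1) := hk ▸ Nat.find_spec hex
  rw [lastReceived_eq h.service_nonneg h1 h2]
  exact ⟨h1, h2⟩

lemma tendsto_lastReceived (hlam : 0 < lam) : Tendsto (lastReceived x s) atTop atTop := by
  refine tendsto_atTop.2 fun m => ?_
  filter_upwards [eventually_ge_atTop (max 0 (departure x s m))] with t ht
  have h2 := (h.lastReceived_spec hlam ((le_max_left _ _).trans ht)).2
  by_contra hlt
  have := departure_mono (x := x) h.service_nonneg (show lastReceived x s t + 1 ≤ m by omega)
  linarith [(le_max_right _ _).trans ht]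

/-- A monotone quantity that grows by `a` per departure grows by `a` per received update. -/
lemma tendsto_div_lastReceived (hlam : 0 < lam) {H : ℝ → ℝ} (hH : MonotoneOn H (Set.Ici 0)) {a : ℝ}
    (ha : Tendsto (fun n : ℕ => H (departure x s n) / n) atTop (𝓝 a)) :
    Tendsto (fun t => H t / lastReceived x s t) atTop (𝓝 a) := by
  have hN := h.tendsto_lastReceived hlam
  have hd0 : ∀ n, 0 ≤ departure x s n := fun n =>
    (show (0 : ℝ) = departure x s 0 from rfl).trans_le (departure_mono h.service_nonneg n.zero_le)
  -- A time `t` lies between departures `N` and `N + 1`; replacing the divisor `N + 1` by `N` does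
  -- not change the limit.
  have hup : Tendsto (fun n : ℕ => H (departure x s (n + 1)) / n) atTop (𝓝 a) := by
    have h1 := (tendsto_add_atTop_iff_nat 1).2 ha
    have h2 := (tendsto_one_div_atTop_nhds_zero_nat (𝕜 := ℝ)).const_add 1
    have h3 := h1.mul h2
    rw [add_zero, mul_one] at h3
    refine h3.congr' ?_
    filter_upwards [eventually_gt_atTop 0] with n hn
    have hn' : (n : ℝ) ≠ 0 := by positivity
    push_cast
    field_simp
  refine tendsto_of_tendsto_of_tendsto_of_le_of_le' (ha.comp hN) (hup.comp hN) ?_ ?_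
  · filter_upwards [eventually_ge_atTop 0] with t ht
    exact div_le_div_of_nonneg_right
      (hH (hd0 _) ht (h.lastReceived_spec hlam ht).1) (Nat.cast_nonneg _)
  · filter_upwards [eventually_ge_atTop 0] with t ht
    exact div_le_div_of_nonneg_right
      (hH ht (hd0 _) (h.lastReceived_spec hlam ht).2.le) (Nat.cast_nonneg _)

lemma age_nonneg (hlam : 0 < lam) {t : ℝ} (ht : 0 ≤ t) : 0 ≤ age x s t := by
  have h1 := (h.lastReceived_spec hlam ht).1
  have h2 := systemTime_nonneg (x := x) h.service_nonneg (lastReceived x s t)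
  rw [departure_eq] at h1
  unfold age
  linarith

lemma age_le (hlam : 0 < lam) {t : ℝ} (ht : 0 ≤ t) :
    age x s t ≤ x (lastReceived x s t) + systemTime x s (lastReceived x s t + 1) := by
  have h1 := (h.lastReceived_spec hlam ht).2
  rw [departure_eq, epoch_succ] at h1
  unfold age
  linarith

/-- By `age_le` the age is controlled by the gap and system time at the index last received, and
this index is at most linear in `t`. The constant depends on the path. -/
lemma age_growth (hlam : 0 < lam) : ∃ C, 0 ≤ C ∧ ∀ t, 0 ≤ t → age x s t ^ 4 ≤ C * (1 + t) := by
  obtain ⟨C₁, h₁⟩ := h.systemTime_growth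
  obtain ⟨C₂, h₂⟩ := h.interarrival_growth
  have hC₁ : 0 ≤ C₁ := by simpa using (by positivity : (0 : ℝ) ≤ systemTime x s 0 ^ 4).trans (h₁ 0)
  have hC₂ : 0 ≤ C₂ := by simpa using (by positivity : (0 : ℝ) ≤ x 0 ^ 4).trans (h₂ 0)
  obtain ⟨A, hA0, hA⟩ : ∃ A, 0 ≤ A ∧ ∀ n : ℕ, (n : ℝ) + 2 ≤ A * (1 + departure x s n) := by
    have hd0 : ∀ n, 0 ≤ departure x s n := fun n =>
      (show (0 : ℝ) = departure x s 0 from rfl).trans_le (departure_mono h.service_nonneg n.zero_le)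
    have hev := h.tendsto_departure_div.eventually
      (lt_mem_nhds (show 1 / (2 * lam) < 1 / lam by
        apply one_div_lt_one_div_of_lt <;> linarith))
    obtain ⟨m, hm⟩ := eventually_atTop.1 hev
    -- Beyond `m`, departures exceed `n / (2 * lam)`; the summand `m + 2` covers the earlier indices
    -- and the shift by `2`.
    refine ⟨2 * lam + m + 2, by positivity, fun n => ?_⟩
    have hd := hd0 n
    rcases le_total n m with hnm | hnm
    · have : (n : ℝ) ≤ m := by exact_mod_cast hnm
      nlinarith [mul_nonneg hlam.le hd, mul_nonneg (Nat.cast_nonneg (α := ℝ) m) hd]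
    · rcases Nat.eq_zero_or_pos n with rfl | hn
      · nlinarith [mul_nonneg hlam.le hd, mul_nonneg (Nat.cast_nonneg (α := ℝ) m) hd,
          Nat.cast_nonneg (α := ℝ) m, Nat.cast_zero (R := ℝ)]
      · have hn' : (0 : ℝ) < n := by exact_mod_cast hn
        have := hm n hnm
        rw [lt_div_iff₀ hn', one_div, inv_mul_lt_iff₀ (by positivity)] at this
        nlinarith [mul_nonneg (Nat.cast_nonneg (α := ℝ) m) hd, Nat.cast_nonneg (α := ℝ) m]
  refine ⟨8 * (C₁ + C₂) * A, by positivity, fun t ht => ?_⟩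
  have hle := h.age_le hlam ht
  have h0 := h.age_nonneg hlam ht
  have hdt := (h.lastReceived_spec hlam ht).1
  set n := lastReceived x s t
  have e1 := h₁ (n + 1)
  have e2 := h₂ n
  push_cast at e1
  have hx0 := h.interarrival_nonneg n
  have hT0 := systemTime_nonneg (x := x) h.service_nonneg (n + 1)
  calc age x s t ^ 4 ≤ (x n + systemTime x s (n + 1)) ^ 4 := pow_le_pow_left₀ h0 hle 4
    _ ≤ 8 * (x n ^ 4 + systemTime x s (n + 1) ^ 4) := by
        have := add_pow_le hx0 hT0 4
        norm_num at this
        exact this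
    _ ≤ 8 * (C₁ + C₂) * (n + 2) := by nlinarith
    _ ≤ 8 * (C₁ + C₂) * (A * (1 + departure x s n)) :=
        mul_le_mul_of_nonneg_left (hA n) (by positivity)
    _ ≤ 8 * (C₁ + C₂) * (A * (1 + t)) := by gcongr
    _ = _ := by ring

omit h in
-- Inside the interval the age is `t - epoch x k`, so the integral is half the difference of the
-- squares of its end values `x k + systemTime x s (k + 1)` and `systemTime x s k`. The squared
-- system times telescope.
lemma _root_.UpdateDecide.integral_age_departure (hs : ∀ n, 0 ≤ s n) (k : ℕ) :
    IntervalIntegrable (age x s) volume (departure x s k) (departure x s (k + 1)) ∧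
    ∫ t in departure x s k..departure x s (k + 1), age x s t =
      x k ^ 2 / 2 + x k * systemTime x s (k + 1) + systemTime x s (k + 1) ^ 2 / 2 -
        systemTime x s k ^ 2 / 2 := by
  have hle := departure_mono (x := x) hs k.le_succ
  have heq : Set.EqOn (fun t => t - epoch x k) (age x s)
      (Set.Ioo (departure x s k) (departure x s (k + 1))) := fun t ht => by
    simp only [age, lastReceived_eq hs ht.1.le ht.2]
  constructor
  · rw [intervalIntegrable_iff_integrableOn_Ioo_of_le hle]
    have : IntervalIntegrable (fun t => t - epoch x k) volume (departure x s k)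
        (departure x s (k + 1)) := Continuous.intervalIntegrable (by fun_prop) _ _
    rw [intervalIntegrable_iff_integrableOn_Ioo_of_le hle] at this
    exact this.congr_fun heq measurableSet_Ioo
  · rw [intervalIntegral.integral_of_le hle, integral_Ioc_eq_integral_Ioo,
      ← setIntegral_congr_fun measurableSet_Ioo heq, ← integral_Ioc_eq_integral_Ioo,
      ← intervalIntegral.integral_of_le hle, intervalIntegral.integral_sub (by simp) (by simp),
      integral_id, intervalIntegral.integral_const, departure_eq x s k, departure_eq x s (k + 1),
      epoch_succ]
    simp only [smul_eq_mul]
    ring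

lemma intervalIntegrable_age_departure (n : ℕ) :
    IntervalIntegrable (age x s) volume 0 (departure x s n) := by
  exact IntervalIntegrable.trans_iterate (a := departure x s) (n := n) fun k _ =>
    (integral_age_departure h.service_nonneg k).1

lemma intervalIntegrable_age (hlam : 0 < lam) {t u : ℝ} (ht : 0 ≤ t) (hu : 0 ≤ u) :
    IntervalIntegrable (age x s) volume t u := by
  have key : ∀ t, 0 ≤ t → IntervalIntegrable (age x s) volume 0 t := fun t ht => by
    obtain ⟨n, hn⟩ := ((h.tendsto_departure hlam).eventually_ge_atTop t).exists
    refine (h.intervalIntegrable_age_departure n).mono_set ?_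
    rw [Set.uIcc_of_le ht, Set.uIcc_of_le (ht.trans hn)]
    exact Set.Icc_subset_Icc_right hn
  exact (key t ht).symm.trans (key u hu)

lemma integral_age_zero_departure (n : ℕ) :
    ∫ t in 0..departure x s n, age x s t =
      ∑ k ∈ Finset.range n, (x k ^ 2 / 2 + x k * systemTime x s (k + 1)) +
        systemTime x s n ^ 2 / 2 := by
  have := intervalIntegral.sum_integral_adjacent_intervals (a := departure x s) (n := n)
    (f := age x s) (μ := volume) fun k _ => (integral_age_departure h.service_nonneg k).1
  rw [show departure x s 0 = 0 from rfl] at this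
  rw [← this]
  simp_rw [fun k => (integral_age_departure (x := x) h.service_nonneg k).2]
  induction n with
  | zero => simp [systemTime_zero]
  | succ n ih =>
    have := ih (intervalIntegral.sum_integral_adjacent_intervals fun k _ =>
      (integral_age_departure h.service_nonneg k).1)
    rw [Finset.sum_range_succ, Finset.sum_range_succ, this]
    ring

/-- The time average of the age. -/
theorem tendsto_average_age (hlam : 0 < lam) :
    Tendsto (fun t => (∫ u in 0..t, age x s u) / t) atTop (𝓝 (lam * c)) := by
  obtain ⟨C, hC⟩ := h.systemTime_growth
  have hsq := tendsto_sq_div_of_pow_four_le hC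
  have hF : Tendsto (fun n : ℕ => (∫ u in 0..departure x s n, age x s u) / n) atTop (𝓝 c) := by
    have := h.tendsto_area.add (hsq.div_const 2)
    rw [zero_div, add_zero] at this
    refine this.congr fun n => ?_
    rw [h.integral_age_zero_departure]
    ring
  have hmono : MonotoneOn (fun t => ∫ u in 0..t, age x s u) (Set.Ici 0) := by
    intro t ht u hu htu
    have := intervalIntegral.integral_add_adjacent_intervals
      (h.intervalIntegrable_age hlam le_rfl ht) (h.intervalIntegrable_age hlam ht hu)
    have h0 : 0 ≤ ∫ v in t..u, age x s v := intervalIntegral.integral_nonneg htu fun v hv =>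
      h.age_nonneg hlam (le_trans ht hv.1)
    simp only
    linarith
  -- Area per received update tends to `c` and time per received update to `1 / lam`; their quotient
  -- is the time average.
  have h1 := h.tendsto_div_lastReceived hlam hmono hF
  have h2 := h.tendsto_div_lastReceived hlam (H := fun t => t) (fun _ _ _ _ h => h)
    h.tendsto_departure_div
  have h3 := h1.div h2 (one_div_pos.2 hlam).ne'
  rw [div_div_eq_mul_div, div_one, mul_comm] at h3
  refine h3.congr' ?_
  filter_upwards [(h.tendsto_lastReceived hlam).eventually_gt_atTop 0] with t ht
  have ht' : (lastReceived x s t : ℝ) ≠ 0 := by positivity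
  simp only [Pi.div_apply]
  rw [div_div_div_cancel_right₀ ht']

end IsRegularPath

/-! ### Joint measurability of the age -/

section Measurability

lemma measurable_epoch (n : ℕ) : Measurable fun x : ℕ → ℝ => epoch x n := by
  unfold epoch
  fun_prop

lemma measurable_departure (n : ℕ) :
    Measurable fun p : (ℕ → ℝ) × (ℕ → ℝ) => departure p.1 p.2 n := by
  induction n with
  | zero => simp only [departure]; fun_prop
  | succ n ih =>
    simp only [departure]
    exact (((measurable_epoch (n + 1)).comp measurable_fst).max ih).add
      ((measurable_pi_apply n).comp measurable_snd)

/-- A description by countable quantifiers, covering the default value `0` on empty and unbounded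
sets, so that `lastReceived` is measurable on all sequences and not only on typical ones. -/
lemma sSup_eq_iff_of_nat (A : Set ℕ) (n : ℕ) : sSup A = n ↔
    (n ∈ A ∧ ∀ k, k ∈ A → k ≤ n) ∨
      (n = 0 ∧ ((∀ k, k ∉ A) ∨ ∀ m, ∃ k, k ∈ A ∧ m < k)) := by
  by_cases hne : A.Nonempty
  · by_cases hb : BddAbove A
    · have hmem := Nat.sSup_mem hne hb
      constructor
      · rintro rfl
        exact .inl ⟨hmem, fun k hk => le_csSup hb hk⟩
      · rintro (⟨h1, h2⟩ | ⟨-, h | h⟩)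
        · exact IsGreatest.csSup_eq ⟨h1, h2⟩
        · exact absurd hmem (h _)
        · obtain ⟨m, hm⟩ := hb
          obtain ⟨k, hk, hmk⟩ := h m
          exact absurd (hm hk) (by omega)
    · rw [Nat.sSup_of_not_bddAbove hb]
      constructor
      · rintro rfl
        refine .inr ⟨rfl, .inr fun m => ?_⟩
        by_contra! hc
        exact hb ⟨m, fun k hk => hc k hk⟩
      · rintro (⟨_, h⟩ | ⟨h, -⟩)
        · exact absurd ⟨n, h⟩ hb
        · exact h.symm
  · rw [Set.not_nonempty_iff_eq_empty] at hne
    subst hne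
    simp [eq_comm]

lemma measurable_lastReceived :
    Measurable fun p : (ℕ → ℝ) × (ℕ → ℝ) × ℝ => lastReceived p.1 p.2.1 p.2.2 := by
  have hA : ∀ k, Measurable fun p : (ℕ → ℝ) × (ℕ → ℝ) × ℝ => departure p.1 p.2.1 k ≤ p.2.2 :=
    fun k => measurableSet_setOfPred.1 (measurableSet_le
      ((measurable_departure k).comp (measurable_fst.prodMk measurable_snd.fst))
      measurable_snd.snd)
  refine measurable_to_countable' fun n => ?_
  have : (fun p : (ℕ → ℝ) × (ℕ → ℝ) × ℝ => lastReceived p.1 p.2.1 p.2.2) ⁻¹' {n} =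
      {p | (departure p.1 p.2.1 n ≤ p.2.2 ∧ ∀ k, departure p.1 p.2.1 k ≤ p.2.2 → k ≤ n) ∨
        (n = 0 ∧ ((∀ k, ¬ departure p.1 p.2.1 k ≤ p.2.2) ∨
          ∀ m, ∃ k, departure p.1 p.2.1 k ≤ p.2.2 ∧ m < k))} := by
    ext p
    exact sSup_eq_iff_of_nat _ n
  rw [this]
  refine measurableSet_setOfPred.2 ?_
  refine ((hA n).and (Measurable.forall fun k => (hA k).imp measurable_const)).or
    (measurable_const.and ((Measurable.forall fun k => (hA k).not).or
      (Measurable.forall fun m => Measurable.exists fun k => (hA k).and measurable_const)))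

lemma measurable_age :
    Measurable fun p : (ℕ → ℝ) × (ℕ → ℝ) × ℝ => age p.1 p.2.1 p.2.2 := by
  unfold age
  refine measurable_snd.snd.sub ?_
  have h : Measurable fun q : (ℕ → ℝ) × ℕ => epoch q.1 q.2 :=
    measurable_from_prod_countable_left measurable_epoch
  exact h.comp (measurable_fst.prodMk measurable_lastReceived)

end Measurability

/-! ### Poisson decisions see time averages -/

/-- The age, cut off at the fourth root of `C * (1 + |t|)`. -/
noncomputable def cappedAge (C : ℝ) (x s : ℕ → ℝ) (t : ℝ) : ℝ :=
  max 0 (min (age x s t) (Real.sqrt (Real.sqrt (C * (1 + |t|)))))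

lemma measurable_cappedAge (C : ℝ) :
    Measurable fun p : (ℕ → ℝ) × (ℕ → ℝ) × ℝ => cappedAge C p.1 p.2.1 p.2.2 := by
  unfold cappedAge
  have := measurable_age
  fun_prop

lemma cappedAge_nonneg (C : ℝ) (x s : ℕ → ℝ) (t : ℝ) : 0 ≤ cappedAge C x s t := le_max_left _ _

lemma cappedAge_le {C : ℝ} (hC : 0 ≤ C) (x s : ℕ → ℝ) {t w : ℝ} (ht : 0 ≤ t) (htw : t ≤ w) :
    cappedAge C x s t ≤ Real.sqrt (Real.sqrt (C * (1 + w))) := by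
  refine (max_le (Real.sqrt_nonneg _) (min_le_right _ _)).trans ?_
  rw [abs_of_nonneg ht]
  gcongr

/-- The cap only serves the moment bounds: by `age_growth` it is inactive on a typical path once `C`
is large. -/
lemma cappedAge_eq {C : ℝ} {x s : ℕ → ℝ} {t : ℝ} (ht : 0 ≤ t) (h0 : 0 ≤ age x s t)
    (h4 : age x s t ^ 4 ≤ C * (1 + t)) : cappedAge C x s t = age x s t := by
  unfold cappedAge
  rw [abs_of_nonneg ht, min_eq_left, max_eq_right h0]
  refine Real.le_sqrt_of_sq_le (Real.le_sqrt_of_sq_le ?_)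
  rwa [← pow_mul]

/-- The capped age at the next decision, compensated by its time integral since the previous
decision: the first argument holds the arrival and service processes and the time of the previous
decision, the second one the time until the next one. -/
noncomputable def decisionIncrement (ν C : ℝ) (q : ((ℕ → ℝ) × (ℕ → ℝ) × ℝ) × ℝ) : ℝ :=
  cappedAge C q.1.1 q.1.2.1 (q.1.2.2 + q.2) -
    ν * ∫ v in Set.Ioo 0 q.2, cappedAge C q.1.1 q.1.2.1 (q.1.2.2 + v)

lemma measurable_integral_cappedAge (C : ℝ) :
    Measurable fun q : ((ℕ → ℝ) × (ℕ → ℝ) × ℝ) × ℝ =>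
      ∫ v in Set.Ioo 0 q.2, cappedAge C q.1.1 q.1.2.1 (q.1.2.2 + v) := by
  have hset : MeasurableSet {r : (((ℕ → ℝ) × (ℕ → ℝ) × ℝ) × ℝ) × ℝ | r.2 ∈ Set.Ioo 0 r.1.2} :=
    (measurableSet_lt measurable_const measurable_snd).inter
      (measurableSet_lt measurable_snd measurable_fst.snd)
  have hm : Measurable fun r : (((ℕ → ℝ) × (ℕ → ℝ) × ℝ) × ℝ) × ℝ =>
      cappedAge C r.1.1.1 r.1.1.2.1 (r.1.1.2.2 + r.2) :=
    (measurable_cappedAge C).comp (measurable_fst.fst.fst.prodMk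
      (measurable_fst.fst.snd.fst.prodMk (measurable_fst.fst.snd.snd.add measurable_snd)))
  have := (hm.indicator hset).stronglyMeasurable.integral_prod_right' (ν := volume)
  convert! this.measurable using 2 with q
  rw [← integral_indicator measurableSet_Ioo]
  rfl

lemma measurable_decisionIncrement (ν C : ℝ) : Measurable (decisionIncrement ν C) :=
  ((measurable_cappedAge C).comp (measurable_fst.fst.prodMk
    (measurable_fst.snd.fst.prodMk (measurable_fst.snd.snd.add measurable_snd)))).sub
    ((measurable_integral_cappedAge C).const_mul ν)

lemma integral_cappedAge_mem_Icc {C : ℝ} (hC : 0 ≤ C) (x s : ℕ → ℝ) {y u : ℝ} (hy : 0 ≤ y)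
    (hu : 0 ≤ u) : ∫ v in Set.Ioo 0 u, cappedAge C x s (y + v) ∈
      Set.Icc 0 (u * Real.sqrt (Real.sqrt (C * (1 + (y + u))))) := by
  constructor
  · exact setIntegral_nonneg measurableSet_Ioo fun v _ => cappedAge_nonneg _ _ _ _
  · have := norm_setIntegral_le_of_norm_le_const (μ := volume) (s := Set.Ioo 0 u)
      (f := fun v => cappedAge C x s (y + v))
      (C := Real.sqrt (Real.sqrt (C * (1 + (y + u))))) (by simp) fun v hv => by
        rw [Real.norm_of_nonneg (cappedAge_nonneg _ _ _ _)]
        exact cappedAge_le hC x s (by linarith [hv.1]) (by linarith [hv.2])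
    refine (le_abs_self _).trans (this.trans ?_)
    simp [hu, mul_comm]

lemma sqrt_sqrt_le {z : ℝ} (hz : 0 ≤ z) : Real.sqrt (Real.sqrt z) ≤ 1 + z := by
  have h1 := Real.sqrt_nonneg (Real.sqrt z)
  have h2 := Real.sq_sqrt (Real.sqrt_nonneg z)
  have h3 := Real.sq_sqrt hz
  nlinarith [sq_nonneg (Real.sqrt (Real.sqrt z) - 1), sq_nonneg (Real.sqrt z - 1)]

/-- This is `integral_integral_expMeasure` for the capped age along a fixed path: `ν` times the
integral compensates the value at the next decision. -/
lemma integral_decisionIncrement {ν C : ℝ} (hν : 0 < ν) (hC : 0 ≤ C) (x s : ℕ → ℝ) {y : ℝ}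
    (hy : 0 ≤ y) : ∫ u, decisionIncrement ν C ((x, s, y), u) ∂expMeasure ν = 0 := by
  have := isProbabilityMeasure_expMeasure hν
  have hm : Measurable fun u => cappedAge C x s (y + u) :=
    (measurable_cappedAge C).comp (measurable_const.prodMk (measurable_const.prodMk
      (measurable_const.add measurable_id)))
  have i1 := integrable_pow_expMeasure hν 1
  have i2 := integrable_pow_expMeasure hν 2
  simp only [pow_one] at i1
  have hbd : ∀ u, 0 < u → Real.sqrt (Real.sqrt (C * (1 + (y + u)))) ≤ 1 + C * (1 + (y + u)) :=
    fun u hu => sqrt_sqrt_le (by positivity)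
  have hi : Integrable (fun u => cappedAge C x s (y + u)) (expMeasure ν) := by
    refine (((i1.const_mul C).add (integrable_const (1 + C * (1 + y))))).mono'
      hm.aestronglyMeasurable ?_
    filter_upwards [ae_expMeasure_pos ν] with u hu
    rw [Real.norm_of_nonneg (cappedAge_nonneg _ _ _ _)]
    refine (cappedAge_le hC x s (by linarith) le_rfl).trans ((hbd u hu).trans (le_of_eq ?_))
    simp only [Pi.add_apply]
    ring
  have hi2 : Integrable (fun u => ∫ v in Set.Ioo 0 u, cappedAge C x s (y + v)) (expMeasure ν) := by
    refine (((i2.const_mul C).add (i1.const_mul (1 + C * (1 + y))))).mono'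
      ((measurable_integral_cappedAge C).comp (measurable_const (a := (x, s, y)).prodMk
        measurable_id)).aestronglyMeasurable ?_
    filter_upwards [ae_expMeasure_pos ν] with u hu
    have h := integral_cappedAge_mem_Icc hC x s hy hu.le
    rw [Real.norm_of_nonneg h.1]
    refine h.2.trans ((mul_le_mul_of_nonneg_left (hbd u hu) hu.le).trans (le_of_eq ?_))
    simp only [Pi.add_apply]
    ring
  simp only [decisionIncrement]
  rw [integral_sub hi (hi2.const_mul ν), integral_const_mul,
    integral_integral_expMeasure hν hm hi]
  field_simp
  ring

/-- The fourth-root cap makes the square of order `√w` with `w = C * (1 + (y + u))`, and `2 * √w ≤ w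
/ N + N` replaces the root by a polynomial with computable mean. For decision time `y` of order `n`,
the choice `N = √(n + 1)` gives a mean of order `√n`. -/
lemma decisionIncrement_sq_le {ν C : ℝ} (hC : 0 ≤ C) (x s : ℕ → ℝ) {y u N : ℝ}
    (hy : 0 ≤ y) (hu : 0 ≤ u) (hN : 0 < N) :
    decisionIncrement ν C ((x, s, y), u) ^ 2 ≤
      (1 + ν ^ 2 * u ^ 2) * (C * (1 + (y + u)) / N + N) := by
  have hw : 0 ≤ C * (1 + (y + u)) := by positivity
  have h1 := cappedAge_le hC x s (add_nonneg hy hu) le_rfl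
  have h0 := cappedAge_nonneg C x s (y + u)
  obtain ⟨h2, h3⟩ := integral_cappedAge_mem_Icc hC x s hy hu
  simp only [decisionIncrement]
  set a := cappedAge C x s (y + u)
  set b := ∫ v in Set.Ioo 0 u, cappedAge C x s (y + v)
  set w := C * (1 + (y + u))
  have hR := Real.sq_sqrt (Real.sqrt_nonneg w)
  have hw' := Real.sq_sqrt hw
  have hq0 := Real.sqrt_nonneg w
  have ha : a ^ 2 ≤ Real.sqrt w := by
    rw [← hR]; exact pow_le_pow_left₀ h0 h1 2
  have hb : b ^ 2 ≤ u ^ 2 * Real.sqrt w := by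
    rw [← hR, ← mul_pow]; exact pow_le_pow_left₀ h2 h3 2
  have hq : 2 * Real.sqrt w ≤ w / N + N := by
    rw [← sub_nonneg]
    have : w / N + N - 2 * Real.sqrt w = (Real.sqrt w - N) ^ 2 / N := by
      field_simp
      nlinarith
    rw [this]
    positivity
  calc (a - ν * b) ^ 2 ≤ 2 * (a ^ 2 + ν ^ 2 * b ^ 2) := by nlinarith [sq_nonneg (a + ν * b)]
    _ ≤ 2 * (Real.sqrt w + ν ^ 2 * (u ^ 2 * Real.sqrt w)) := by gcongr
    _ = (1 + ν ^ 2 * u ^ 2) * (2 * Real.sqrt w) := by ring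
    _ ≤ _ := mul_le_mul_of_nonneg_left hq (by positivity)

/-- The indices of the variables that determine the arrivals, the services and the first `n`
decisions. -/
def decisionIndices (n : ℕ) : Set (ℕ ⊕ (ℕ ⊕ ℕ)) :=
  Sum.elim (fun _ => True) (Sum.elim (fun _ => True) (· < n))

lemma monotone_decisionIndices : Monotone decisionIndices := by
  rintro m n h (i | i | i) hi
  · exact trivial
  · exact trivial
  · exact lt_of_lt_of_le (show i < m from hi) h

section Decisions

variable {Ω : Type*} {mΩ : MeasurableSpace Ω} {P : Measure Ω} [IsProbabilityMeasure P]
  {X S Z : ℕ → Ω → ℝ} {lam ν : ℝ} {κ : Measure ℝ}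

omit mΩ in
lemma measurable_past_decision (X S Z : ℕ → Ω → ℝ) (n : ℕ) :
    Measurable[past (Sum.elim X (Sum.elim S Z)) (decisionIndices n)] fun ω =>
      ((fun i => X i ω), (fun i => S i ω), epoch (fun i => Z i ω) n) := by
  set V := Sum.elim X (Sum.elim S Z)
  refine Measurable.prodMk ?_ (Measurable.prodMk ?_ ?_)
  · exact @measurable_pi_lambda _ _ _ (past V (decisionIndices n)) _ _ fun i =>
      measurable_past V (I := decisionIndices n) (i := .inl i) trivial
  · exact @measurable_pi_lambda _ _ _ (past V (decisionIndices n)) _ _ fun i =>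
      measurable_past V (I := decisionIndices n) (i := .inr (.inl i)) trivial
  · unfold epoch
    refine Finset.measurable_sum (m := past V (decisionIndices n)) _ fun i hi => ?_
    exact measurable_past V (I := decisionIndices n) (i := .inr (.inr i)) (Finset.mem_range.1 hi)

omit [IsProbabilityMeasure P] in
lemma indep_past_decision (hX : ∀ i, Measurable (X i)) (hS : ∀ i, Measurable (S i))
    (hZ : ∀ i, Measurable (Z i)) (hind : iIndepFun (Sum.elim X (Sum.elim S Z)) P) (n : ℕ) :
    Indep (past (Sum.elim X (Sum.elim S Z)) (decisionIndices n))
      (MeasurableSpace.comap (Z n) inferInstance) P := by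
  refine indep_past (measurable_family hX hS hZ) hind (J := {.inr (.inr n)}) ?_
    (measurable_past (Sum.elim X (Sum.elim S Z)) (i := .inr (.inr n)) rfl)
  rw [Set.disjoint_right]
  rintro _ rfl h
  exact lt_irrefl n h

/-- For the capped age, the decisions see time averages. -/
lemma ae_tendsto_average_decisionIncrement (h : IsMG1M P X S Z lam κ ν) (hν : 0 < ν)
    (hX : ∀ i, Measurable (X i)) (hS : ∀ i, Measurable (S i)) (hZ : ∀ i, Measurable (Z i))
    {C : ℝ} (hC : 0 ≤ C) :
    ∀ᵐ ω ∂P, Tendsto (fun n : ℕ => (∑ k ∈ Finset.range n, decisionIncrement ν C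
      (((fun i => X i ω), (fun i => S i ω), epoch (fun i => Z i ω) k), Z k ω)) / n)
      atTop (𝓝 0) := by
  have := isProbabilityMeasure_expMeasure hν
  have hZ0 : ∀ᵐ ω ∂P, ∀ n, 0 < Z n ω := ae_all_iff.2 fun n =>
    ae_of_hasLaw (h.law_interdecision n) (ae_expMeasure_pos ν)
  have hτ0 : ∀ᵐ ω ∂P, ∀ n, 0 ≤ epoch (fun i => Z i ω) n :=
    hZ0.mono fun ω hω n => Finset.sum_nonneg fun i _ => (hω i).le
  have hYm := fun n => measurable_past_decision X S Z n
  have hYm' := fun n => (hYm n).mono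
    ((pastFiltration (measurable_family hX hS hZ) monotone_decisionIndices).le n) le_rfl
  have hτm : ∀ n, Measurable fun ω => epoch (fun i => Z i ω) n := fun n => (hYm' n).snd.snd
  have hZp : ∀ p n, _ := fun p n => pow_of_hasLaw (h.law_interdecision n) p
    (integrable_pow_expMeasure hν p)
  have hZi : ∀ n, Integrable (Z n) P ∧ ∫ ω, Z n ω ∂P = 1 / ν := fun n => by
    have := hZp 1 n
    simpa only [pow_one, integral_id_expMeasure hν] using this
  have hτi : ∀ n, Integrable (fun ω => epoch (fun i => Z i ω) n) P ∧
      ∫ ω, epoch (fun i => Z i ω) n ∂P = n / ν := fun n => by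
    unfold epoch
    refine ⟨integrable_finsetSum _ fun i _ => (hZi i).1, ?_⟩
    rw [integral_finsetSum _ fun i _ => (hZi i).1]
    simp [(hZi _).2, div_eq_mul_inv]
  have hWi : ∀ n, Integrable (fun ω => 1 + ν ^ 2 * Z n ω ^ 2) P ∧
      ∫ ω, (1 + ν ^ 2 * Z n ω ^ 2) ∂P = 3 := fun n => by
    have hi := (hZp 2 n).1.const_mul (ν ^ 2)
    refine ⟨(integrable_const 1).add hi, ?_⟩
    rw [integral_add (integrable_const 1) hi, integral_const_mul, (hZp 2 n).2,
      integral_sq_expMeasure hν]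
    simp only [integral_const, probReal_univ, smul_eq_mul]
    field_simp
    norm_num
  set Q := ∫ u, (1 + u + ν ^ 2 * u ^ 2 + ν ^ 2 * u ^ 3) ∂expMeasure ν with hQ
  have hQi : Integrable (fun u => 1 + u + ν ^ 2 * u ^ 2 + ν ^ 2 * u ^ 3) (expMeasure ν) := by
    have i1 := integrable_pow_expMeasure hν 1
    simp only [pow_one] at i1
    exact (((integrable_const 1).add i1).add ((integrable_pow_expMeasure hν 2).const_mul _)).add
      ((integrable_pow_expMeasure hν 3).const_mul _)
  have hQ0 : 0 ≤ Q := integral_nonneg_of_ae <| by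
    filter_upwards [ae_expMeasure_pos ν] with u hu
    simp only [Pi.zero_apply]
    positivity
  have hVi : ∀ n, Integrable (fun ω => 1 + Z n ω + ν ^ 2 * Z n ω ^ 2 + ν ^ 2 * Z n ω ^ 3) P ∧
      ∫ ω, (1 + Z n ω + ν ^ 2 * Z n ω ^ 2 + ν ^ 2 * Z n ω ^ 3) ∂P = Q := fun n => by
    have hi := hQi
    constructor
    · rw [← (h.law_interdecision n).map_eq] at hi
      exact hi.comp_measurable (hZ n)
    · rw [hQ, ← (h.law_interdecision n).map_eq, integral_map (hZ n).aemeasurable (by fun_prop)]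
  have hind : ∀ n, IndepFun (fun ω => epoch (fun i => Z i ω) n)
      (fun ω => 1 + ν ^ 2 * Z n ω ^ 2) P := fun n => by
    have h1 : IndepFun (fun ω => epoch (fun i => Z i ω) n) (Z n) P :=
      indep_of_indep_of_le_left (indep_past_decision hX hS hZ h.indep n) (hYm n).snd.snd.comap_le
    exact h1.comp (φ := id) (ψ := fun u => 1 + ν ^ 2 * u ^ 2) measurable_id (by fun_prop)
  have hτW : ∀ n, Integrable (fun ω => epoch (fun i => Z i ω) n * (1 + ν ^ 2 * Z n ω ^ 2)) P ∧
      ∫ ω, epoch (fun i => Z i ω) n * (1 + ν ^ 2 * Z n ω ^ 2) ∂P = n / ν * 3 := fun n => by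
    refine ⟨(hind n).integrable_mul (hτi n).1 (hWi n).1, ?_⟩
    rw [(hind n).integral_fun_mul_eq_mul_integral (hτi n).1.aestronglyMeasurable
      (hWi n).1.aestronglyMeasurable, (hτi n).2, (hWi n).2]
  set D : ℕ → Ω → ℝ := fun n ω => decisionIncrement ν C
    (((fun i => X i ω), (fun i => S i ω), epoch (fun i => Z i ω) n), Z n ω) with hD
  have hDm : ∀ n, Measurable (D n) := fun n =>
    (measurable_decisionIncrement ν C).comp ((hYm' n).prodMk (hZ n))
  have hN : ∀ n : ℕ, 0 < Real.sqrt ((n : ℝ) + 1) := fun n => Real.sqrt_pos.2 (by positivity)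
  -- The bound of `decisionIncrement_sq_le` with `N = √(n + 1)`, expanded so that the past `epoch`
  -- occurs only in a product with an independent factor.
  set E : ℕ → Ω → ℝ := fun n ω => C / Real.sqrt ((n : ℝ) + 1) *
      (1 + Z n ω + ν ^ 2 * Z n ω ^ 2 + ν ^ 2 * Z n ω ^ 3) +
      C / Real.sqrt ((n : ℝ) + 1) * (epoch (fun i => Z i ω) n * (1 + ν ^ 2 * Z n ω ^ 2)) +
      Real.sqrt ((n : ℝ) + 1) * (1 + ν ^ 2 * Z n ω ^ 2) with hE
  have hE12 : ∀ n : ℕ, Integrable (fun ω => C / Real.sqrt ((n : ℝ) + 1) *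
      (1 + Z n ω + ν ^ 2 * Z n ω ^ 2 + ν ^ 2 * Z n ω ^ 3) +
      C / Real.sqrt ((n : ℝ) + 1) * (epoch (fun i => Z i ω) n * (1 + ν ^ 2 * Z n ω ^ 2))) P :=
    fun n => ((hVi n).1.const_mul _).add ((hτW n).1.const_mul _)
  have hEi : ∀ n, Integrable (E n) P := fun n => (hE12 n).add ((hWi n).1.const_mul _)
  have hEv : ∀ n : ℕ, ∫ ω, E n ω ∂P ≤ (C * Q + 3 * C / ν + 3) * Real.sqrt ((n : ℝ) + 1) := by
    intro n
    rw [hE, integral_add (hE12 n) ((hWi n).1.const_mul _),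
      integral_add ((hVi n).1.const_mul _) ((hτW n).1.const_mul _), integral_const_mul,
      integral_const_mul, integral_const_mul, (hVi n).2, (hτW n).2, (hWi n).2]
    have hs := Real.mul_self_sqrt (show (0 : ℝ) ≤ (n : ℝ) + 1 by positivity)
    have hs1 : 1 ≤ Real.sqrt ((n : ℝ) + 1) := Real.one_le_sqrt.2 (by simp)
    have hs0 := hN n
    set R := Real.sqrt ((n : ℝ) + 1)
    have e1 : C / R * Q ≤ C * Q * R := by
      rw [div_mul_eq_mul_div, div_le_iff₀ hs0]
      have : 0 ≤ C * Q := mul_nonneg hC hQ0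
      nlinarith
    have e2 : C / R * (n / ν * 3) ≤ 3 * C / ν * R := by
      have : C / R * (n / ν * 3) = 3 * C / ν * (n / R) := by field_simp
      rw [this]
      refine mul_le_mul_of_nonneg_left ?_ (by positivity)
      rw [div_le_iff₀ hs0, hs]
      linarith
    linarith
  have hle : ∀ n, ∀ᵐ ω ∂P, D n ω ^ 2 ≤ E n ω := fun n => by
    filter_upwards [hZ0, hτ0] with ω h1 h2
    refine (decisionIncrement_sq_le hC _ _ (h2 n) (h1 n).le (hN n)).trans (le_of_eq ?_)
    simp only [hE]
    ring
  have hint : ∀ n, Integrable (fun ω => D n ω ^ 2) P := fun n => by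
    refine (hEi n).mono' ((hDm n).pow_const 2).aestronglyMeasurable ?_
    filter_upwards [hle n] with ω hω
    rwa [Real.norm_of_nonneg (sq_nonneg _)]
  -- Second moments of order `√n` leave the terms `n ^ (-3/2)`; a square-root cap would give order
  -- `n` and the harmonic series.
  have hsum : Summable fun n : ℕ =>
      (C * Q + 3 * C / ν + 3) * Real.sqrt ((n : ℝ) + 1) / ((n : ℝ) + 1) ^ 2 := by
    have := ((summable_nat_add_iff 1).2 (Real.summable_one_div_nat_rpow.2
      (show (1 : ℝ) < 3 / 2 by norm_num))).mul_left (C * Q + 3 * C / ν + 3)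
    refine this.congr fun n => ?_
    have hp : (0 : ℝ) < (n : ℝ) + 1 := by positivity
    push_cast
    rw [Real.sqrt_eq_rpow, mul_div_assoc _ (_ ^ _), ← Real.rpow_natCast, ← Real.rpow_sub hp,
      one_div, ← Real.rpow_neg hp.le]
    norm_num
  exact ae_tendsto_average_zero_of_indep (P := P)
    (pastFiltration (measurable_family hX hS hZ) monotone_decisionIndices)
    (g := decisionIncrement ν C) hYm
    (fun n => measurable_past (Sum.elim X (Sum.elim S Z)) (I := decisionIndices (n + 1))
      (i := .inr (.inr n)) n.lt_succ_self)
    (fun n => indep_past_decision hX hS hZ h.indep n) (measurable_decisionIncrement ν C)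
    (fun n => hτ0.mono fun ω hω => by
      rw [(h.law_interdecision n).map_eq]
      exact integral_decisionIncrement hν hC _ _ (hω n))
    hint (fun n => (integral_mono_ae (hint n) (hEi n) (hle n)).trans (hEv n)) hsum

end Decisions

/-! ### Average AuD for a general service law -/

section Decisions

/-- The compensating integrals run over consecutive inter-decision intervals and fill `[0, epoch z
n]`. Increment `k` carries the age at decision `k + 1`. -/
lemma sum_decisionIncrement_eq {x s z : ℕ → ℝ} {lam c ν C : ℝ} (h : IsRegularPath x s lam c)
    (hlam : 0 < lam) (hz : ∀ n, 0 ≤ z n) (hC : ∀ t, 0 ≤ t → age x s t ^ 4 ≤ C * (1 + t)) (n : ℕ) :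
    ∑ k ∈ Finset.range n, decisionIncrement ν C ((x, s, epoch z k), z k) =
      ∑ j ∈ Finset.Icc 1 n, ageUponDecision x s z j - ν * ∫ t in 0..epoch z n, age x s t := by
  have hτ : ∀ n, 0 ≤ epoch z n := fun n => Finset.sum_nonneg fun i _ => hz i
  have hcap : ∀ t, 0 ≤ t → cappedAge C x s t = age x s t := fun t ht =>
    cappedAge_eq ht (h.age_nonneg hlam ht) (hC t ht)
  induction n with
  | zero => simp [epoch]
  | succ n ih =>
    have e1 : decisionIncrement ν C ((x, s, epoch z n), z n) = ageUponDecision x s z (n + 1) -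
        ν * ∫ t in epoch z n..epoch z (n + 1), age x s t := by
      have e2 : ∫ v in Set.Ioo 0 (z n), cappedAge C x s (epoch z n + v) =
          ∫ t in epoch z n..epoch z (n + 1), age x s t := by
        rw [epoch_succ, setIntegral_congr_fun measurableSet_Ioo
          (g := fun v => age x s (epoch z n + v))
          (fun v hv => hcap _ (add_nonneg (hτ n) hv.1.le)),
          ← integral_Ioc_eq_integral_Ioo, ← intervalIntegral.integral_of_le (hz n),
          intervalIntegral.integral_comp_add_left (fun t => age x s t), add_zero]
      simp only [decisionIncrement]
      rw [e2, hcap _ (add_nonneg (hτ n) (hz n)), ageUponDecision, epoch_succ]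
    rw [Finset.sum_range_succ, ih, e1, Finset.sum_Icc_succ_top (by omega),
      ← intervalIntegral.integral_add_adjacent_intervals
        (h.intervalIntegrable_age hlam le_rfl (hτ n))
        (h.intervalIntegrable_age hlam (hτ n) (hτ (n + 1)))]
    ring

lemma tendsto_epoch_atTop {z : ℕ → ℝ} {ν : ℝ} (hν : 0 < ν)
    (h : Tendsto (fun n : ℕ => epoch z n / n) atTop (𝓝 (1 / ν))) :
    Tendsto (epoch z) atTop atTop := by
  have := h.pos_mul_atTop (one_div_pos.2 hν) (tendsto_natCast_atTop_atTop (R := ℝ))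
  refine this.congr' ?_
  filter_upwards [eventually_gt_atTop 0] with n hn
  have hn' : (n : ℝ) ≠ 0 := by positivity
  field_simp

lemma tendsto_numDecisions {z : ℕ → ℝ} (hz : ∀ n, 0 ≤ z n)
    (h : Tendsto (epoch z) atTop atTop) : Tendsto (numDecisions z) atTop atTop := by
  refine tendsto_atTop.2 fun m => ?_
  filter_upwards [eventually_ge_atTop (epoch z m)] with T hT
  obtain ⟨n, hn⟩ := (h.eventually_gt_atTop T).exists
  -- Finiteness is essential, since `Set.ncard` is `0` on infinite sets.
  have hfin : {j : ℕ | 1 ≤ j ∧ epoch z j ≤ T}.Finite := by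
    refine (Set.finite_Iio n).subset fun j hj => ?_
    by_contra hnj
    have := epoch_mono hz (not_lt.1 hnj)
    linarith [hj.2]
  have hsub : ((Finset.Icc 1 m : Finset ℕ) : Set ℕ) ⊆ {j : ℕ | 1 ≤ j ∧ epoch z j ≤ T} := by
    intro j hj
    rw [Finset.coe_Icc] at hj
    exact ⟨hj.1, (epoch_mono hz hj.2).trans hT⟩
  have := Set.ncard_le_ncard hsub hfin
  rwa [Set.ncard_coe_finset, Nat.card_Icc, Nat.add_sub_cancel] at this

variable {Ω : Type*} {mΩ : MeasurableSpace Ω} {P : Measure Ω} [IsProbabilityMeasure P]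
  {X S Z : ℕ → Ω → ℝ} {lam ν : ℝ} {κ : Measure ℝ} [IsProbabilityMeasure κ]

lemma hasAverageAuD_of_measurable (h : IsMG1M P X S Z lam κ ν) (hlam : 0 < lam) (hν : 0 < ν)
    (hX : ∀ i, Measurable (X i)) (hS : ∀ i, Measurable (S i)) (hZ : ∀ i, Measurable (Z i))
    (h0 : ∀ᵐ s ∂κ, 0 ≤ s) {t : ℝ} (ht : 0 < t) (hi : Integrable (fun s => Real.exp (t * s)) κ)
    (hm : lam * ∫ s, s ∂κ < 1) : HasAverageAuD P X S Z (lam * areaPerUpdate lam κ) := by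
  have hZ0 : ∀ᵐ ω ∂P, ∀ n, 0 ≤ Z n ω := ae_all_iff.2 fun n =>
    ae_of_hasLaw (h.law_interdecision n) ((ae_expMeasure_pos ν).mono fun _ h => h.le)
  have hepoch := ae_tendsto_epoch hν h.law_interdecision fun i j hij =>
    h.indep.indepFun (i := .inr (.inr i)) (j := .inr (.inr j)) (by simpa using hij)
  -- The growth constant depends on the path, so one null set must serve all caps; natural numbers
  -- suffice.
  have hdec : ∀ᵐ ω ∂P, ∀ m : ℕ, Tendsto (fun n : ℕ => (∑ k ∈ Finset.range n, decisionIncrement ν m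
      (((fun i => X i ω), (fun i => S i ω), epoch (fun i => Z i ω) k), Z k ω)) / n)
      atTop (𝓝 0) := ae_all_iff.2 fun m =>
    ae_tendsto_average_decisionIncrement h hν hX hS hZ (Nat.cast_nonneg m)
  filter_upwards [ae_isRegularPath h hlam hX hS hZ h0 ht hi hm, hZ0, hepoch, hdec] with
    ω hreg hz hτ hω
  obtain ⟨C, hC0, hC⟩ := hreg.age_growth hlam
  obtain ⟨m, hm'⟩ := exists_nat_ge C
  have hCm : ∀ t, 0 ≤ t → age (fun i => X i ω) (fun i => S i ω) t ^ 4 ≤ m * (1 + t) :=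
    fun t ht => (hC t ht).trans (mul_le_mul_of_nonneg_right hm' (by linarith))
  have hτ' := tendsto_epoch_atTop hν hτ
  -- The integral of the age up to decision `n`, divided by `n`, is the time average times `epoch /
  -- n`, which tends to `1 / ν`; the compensator's factor `ν` cancels it.
  have h1 := (hreg.tendsto_average_age hlam).comp hτ'
  have h2 := (hω m).add ((h1.mul hτ).const_mul ν)
  have h3 : ν * (lam * areaPerUpdate lam κ * (1 / ν)) = lam * areaPerUpdate lam κ := by
    field_simp
  rw [zero_add, h3] at h2
  have h4 : Tendsto (fun n : ℕ => (1 / (n : ℝ)) * ∑ j ∈ Finset.Icc 1 n,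
      ageUponDecision (fun i => X i ω) (fun i => S i ω) (fun i => Z i ω) j) atTop
      (𝓝 (lam * areaPerUpdate lam κ)) := by
    refine h2.congr' ?_
    filter_upwards [hτ'.eventually_gt_atTop 0] with n hn
    rw [sum_decisionIncrement_eq hreg hlam hz hCm, Function.comp_apply]
    field_simp
    ring
  exact h4.comp (tendsto_numDecisions hz hτ')

/-- The average age upon decision of an M/G/1/M system whose service law has an exponential
moment. -/
theorem hasAverageAuD (h : IsMG1M P X S Z lam κ ν) (hlam : 0 < lam) (hν : 0 < ν)
    (h0 : ∀ᵐ s ∂κ, 0 ≤ s) {t : ℝ} (ht : 0 < t) (hi : Integrable (fun s => Real.exp (t * s)) κ)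
    (hm : lam * ∫ s, s ∂κ < 1) : HasAverageAuD P X S Z (∫ s, s ∂κ +
      lam * (∫ s, s ^ 2 ∂κ) / (2 * (1 - lam * ∫ s, s ∂κ)) +
      (1 - lam * ∫ s, s ∂κ) / (lam * ∫ s, Real.exp (-(lam * s)) ∂κ)) := by
  have hXm := fun i => (h.law_interarrival i).aemeasurable
  have hSm := fun i => (h.law_service i).aemeasurable
  have hZm := fun i => (h.law_interdecision i).aemeasurable
  -- `HasLaw` gives only almost everywhere measurability. Measurable versions agree with the
  -- originals for all indices off one null set.
  have h' : IsMG1M P (fun i => (hXm i).mk) (fun i => (hSm i).mk) (fun i => (hZm i).mk) lam κ ν :=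
    { law_interarrival := fun i => (h.law_interarrival i).congr (hXm i).ae_eq_mk.symm
      law_service := fun i => (h.law_service i).congr (hSm i).ae_eq_mk.symm
      law_interdecision := fun i => (h.law_interdecision i).congr (hZm i).ae_eq_mk.symm
      indep := by
        refine h.indep.congr ?_
        rintro (i | i | i)
        exacts [(hXm i).ae_eq_mk, (hSm i).ae_eq_mk, (hZm i).ae_eq_mk] }
  have key := hasAverageAuD_of_measurable h' hlam hν (fun i => (hXm i).measurable_mk)
    (fun i => (hSm i).measurable_mk) (fun i => (hZm i).measurable_mk) h0 ht hi hm
  rw [areaPerUpdate, mul_div_cancel₀ _ hlam.ne'] at key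
  filter_upwards [key, ae_all_iff.2 fun i => (hXm i).ae_eq_mk, ae_all_iff.2 fun i => (hSm i).ae_eq_mk,
    ae_all_iff.2 fun i => (hZm i).ae_eq_mk] with ω hω h1 h2 h3
  simpa only [h1, h2, h3] using hω

end Decisions

/-! ### The three service laws -/

section ServiceLaws

lemma integral_uniformService {μ : ℝ} (hμ : 0 < μ) (f : ℝ → ℝ) :
    ∫ s, f s ∂uniformService μ = μ / 2 * ∫ s in 0..2 / μ, f s := by
  have h2 : (0 : ℝ) ≤ 2 / μ := by positivity
  rw [uniformService, ProbabilityTheory.cond, integral_smul_measure, Real.volume_Ioo, sub_zero,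
    ENNReal.toReal_inv, ENNReal.toReal_ofReal h2, intervalIntegral.integral_of_le h2, integral_Ioc_eq_integral_Ioo,
    inv_div, smul_eq_mul]

lemma isProbabilityMeasure_uniformService {μ : ℝ} (hμ : 0 < μ) :
    IsProbabilityMeasure (uniformService μ) := by
  refine cond_isProbabilityMeasure_of_finite ?_ ?_
  · simpa using hμ
  · simp

lemma ae_uniformService_mem {μ : ℝ} : ∀ᵐ s ∂uniformService μ, s ∈ Set.Ioo 0 (2 / μ) :=
  ae_cond_mem measurableSet_Ioo

end ServiceLaws

end UpdateDecide

theorem corollary1 {Ω : Type*} [MeasurableSpace Ω] (P : Measure Ω) [IsProbabilityMeasure P]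
    (X S Z : ℕ → Ω → ℝ) (lam μ ν ρ : ℝ) (hlam : 0 < lam) (hμ : 0 < μ) (hν : 0 < ν)
    (hρ : ρ = lam / μ) (hρ1 : ρ < 1) :
    (UpdateDecide.IsMG1M P X S Z lam (UpdateDecide.uniformService μ) ν →
      UpdateDecide.HasAverageAuD P X S Z
        (ρ * (6 * ρ ^ 2 * Real.exp (2 * ρ) - 13 * ρ * Real.exp (2 * ρ) + 9 * Real.exp (2 * ρ)
            + ρ - 3) / (3 * lam * (1 - ρ) * (Real.exp (2 * ρ) - 1)))) ∧
    (UpdateDecide.IsMG1M P X S Z lam (UpdateDecide.exponentialService μ) ν →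
      UpdateDecide.HasAverageAuD P X S Z
        ((ρ ^ 3 - ρ ^ 2 + 1) / (lam * (1 - ρ)))) ∧
    (UpdateDecide.IsMG1M P X S Z lam (UpdateDecide.deterministicService μ) ν →
      UpdateDecide.HasAverageAuD P X S Z
        ((ρ ^ 2 + 2 * (1 - ρ) * (ρ + Real.exp ρ - ρ * Real.exp ρ)) / (2 * lam * (1 - ρ)))) := by
  have hρ0 : 0 < ρ := by rw [hρ]; positivity
  have hμρ : μ = lam / ρ := by rw [hρ]; field_simp
  have h1ρ : 1 - ρ ≠ 0 := by linarith
  have hmean : lam * (1 / μ) = ρ := by rw [hρ]; ring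
  refine ⟨fun h => ?_, fun h => ?_, fun h => ?_⟩
  · have := UpdateDecide.isProbabilityMeasure_uniformService hμ
    have hmem := UpdateDecide.ae_uniformService_mem (μ := μ)
    have m1 : ∫ s, s ∂UpdateDecide.uniformService μ = 1 / μ := by
      rw [UpdateDecide.integral_uniformService hμ, integral_id]
      field_simp
      norm_num
    have m2 : ∫ s, s ^ 2 ∂UpdateDecide.uniformService μ = 4 / (3 * μ ^ 2) := by
      rw [UpdateDecide.integral_uniformService hμ, integral_pow, div_pow]
      field_simp
      norm_num
      ring
    have G : ∫ s, Real.exp (-(lam * s)) ∂UpdateDecide.uniformService μ =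
        (1 - (Real.exp (2 * ρ))⁻¹) / (2 * ρ) := by
      rw [UpdateDecide.integral_uniformService hμ]
      have hd : ∀ s ∈ Set.uIcc 0 (2 / μ), HasDerivAt
          (fun s => -(1 / lam) * Real.exp (-(lam * s))) (Real.exp (-(lam * s))) s := fun s _ =>
        ((UpdateDecide.hasDerivAt_exp_neg_mul lam s).const_mul _).congr_deriv (by field_simp)
      rw [intervalIntegral.integral_eq_sub_of_hasDerivAt hd
        (Continuous.intervalIntegrable (by fun_prop) _ _),
        show -(lam * (2 / μ)) = -(2 * ρ) by rw [hρ]; ring, Real.exp_neg, hμρ]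
      simp only [mul_zero, neg_zero, Real.exp_zero]
      field_simp
      ring
    have key := UpdateDecide.hasAverageAuD h hlam hν (hmem.mono fun s hs => hs.1.le) one_pos
      (Integrable.of_bound (C := Real.exp (2 / μ)) (by fun_prop) (hmem.mono fun s hs => by
        rw [Real.norm_of_nonneg (Real.exp_pos _).le, one_mul]
        exact Real.exp_le_exp.2 hs.2.le)) (by rwa [m1, hmean])
    -- With `μ = lam / ρ`, what remains is a rational identity in `lam`, `ρ` and `exp (2 * ρ)`.
    rw [m1, m2, G, hmean, hμρ] at key
    convert! key using 1
    have he : Real.exp (2 * ρ) - 1 ≠ 0 := by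
      have := Real.add_one_lt_exp (show 2 * ρ ≠ 0 by positivity)
      linarith
    have he0 : Real.exp (2 * ρ) ≠ 0 := (Real.exp_pos _).ne'
    have he' : 1 - (Real.exp (2 * ρ))⁻¹ ≠ 0 := by
      rw [show 1 - (Real.exp (2 * ρ))⁻¹ = (Real.exp (2 * ρ) - 1) / Real.exp (2 * ρ) by field_simp]
      exact div_ne_zero he he0
    set E := Real.exp (2 * ρ)
    rw [show 1 - E⁻¹ = (E - 1) / E by field_simp]
    field_simp
    ring
  · have := isProbabilityMeasure_expMeasure hμ
    have key := UpdateDecide.hasAverageAuD (κ := expMeasure μ) h hlam hν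
      ((UpdateDecide.ae_expMeasure_pos μ).mono fun _ hs => hs.le) (half_pos hμ)
      (UpdateDecide.integrable_exp_mul_expMeasure hμ (half_lt_self hμ))
      (by rwa [UpdateDecide.integral_id_expMeasure hμ, hmean])
    -- The Laplace transform of the service law at `lam` is the moment generating function at
    -- `-lam`, namely `μ / (μ + lam) = 1 / (1 + ρ)`.
    have G := UpdateDecide.integral_exp_mul_expMeasure hμ (t := -lam) (by linarith)
    simp only [neg_mul] at G
    rw [UpdateDecide.integral_id_expMeasure hμ, UpdateDecide.integral_sq_expMeasure hμ, G,
      hmean, hμρ] at key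
    convert! key using 1
    have : lam / ρ - -lam ≠ 0 := by
      have : 0 < lam / ρ := by positivity
      linarith
    rw [show lam / ρ - -lam = lam * (1 + ρ) / ρ by field_simp; ring]
    have h2 : 1 + ρ ≠ 0 := by linarith
    field_simp
    ring
  · have key := UpdateDecide.hasAverageAuD (κ := Measure.dirac (1 / μ)) h hlam hν
      (by rw [ae_dirac_iff measurableSet_Ici]; positivity) one_pos
      (integrable_dirac (by simp)) (by rwa [integral_dirac, hmean])
    rw [integral_dirac, integral_dirac, integral_dirac, hmean, Real.exp_neg, hμρ] at key
    convert! key using 1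
    have he0 : Real.exp ρ ≠ 0 := (Real.exp_pos _).ne'
    field_simp
    ring
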